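/- Let $\mathcal X,\mathcal Y$ be finite-dimensional real inner product spaces. Consider $\min_{x\in\mathcal X}\max_{y\in\mathcal Y}\mathcal L(x,y)=f(x)+\Phi(x,y)-g(y)$, where $f:\mathcal X\to\mathbb R\cup\{\infty\}$ and $g:\mathcal Y\to\mathbb R\cup\{\infty\}$ are proper, closed and convex with moduli $\mu_x,\mu_y\ge 0$ (that is, $f-\frac{\mu_x}{2}\|\cdot\|^2$ and $g-\frac{\mu_y}{2}\|\cdot\|^2$ are convex) and $\Phi:\mathcal X\times\mathcal Y\to\mathbb R$ satisfies, for some constants $L_{xx},L_{yy}\ge0$ and $L_{xy},L_{yx}>0$: - for every $y\in\operatorname{dom}g$, $\Phi(\cdot,y)$ is convex and differentiable on $\mathcal X$; for every $x\in\operatorname{dom}f$, $\Phi(x,\cdot)$ is concave and differentiable on $\mathcal Y$; - for all $x,\bar x\in\operatorname{dom}f$ and $y,\bar y\in\operatorname{dom}g$, $\|\nabla_x\Phi(x,y)-\nabla_x\Phi(\bar x,\bar y)\|\le L_{xx}\|x-\bar x\|+L_{xy}\|y-\bar y\|$ and $\|\nabla_y\Phi(x,y)-\nabla_y\Phi(\bar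 x,\bar y)\|\le L_{yx}\|x-\bar x\|+L_{yy}\|y-\bar y\|$. Let $(x^*,y^*)\in\operatorname{dom}f\times\operatorname{dom}g$ be a saddle point, i.e. $\mathcal L(x^*,y)\le\mathcal L(x^*,y^*)\le\mathcal L(x,y^*)$ for all $x\in\mathcal X$, $y\in\mathcal Y$. For $\tau,\sigma>0$, $\theta\ge0$ and a deterministic starting point $(x_0,y_0)=(x_{-1},y_{-1})\in\operatorname{dom}f\times\operatorname{dom}g$, let $\{x_k,y_k\}_{k\ge0}$ be generated by the stochastic accelerated primal-dual (SAPD) algorithm: for $k\ge0$, $$\tilde s_k=\tilde\nabla_y\Phi(x_k,y_k;\omega_k^y)+\theta\big(\tilde\nabla_y\Phi(x_k,y_k;\omega_k^y)-\tilde\nabla_y\Phi(x_{k-1},y_{k-1};\omega_{k-1}^y)\big),$$ $$y_{k+1}=\operatorname{prox}_{\sigma g}(y_k+\sigma\tilde s_k),\qquad x_{k+1}=\operatorname{prox}_{\tau f}\big(x_k-\tau\tilde\nabla_x\Phi(x_k,y_{k+1};\omega_k^x)\big),$$ where $\operatorname{prox}_{h}(u)=\arg\min_v h(v)+\frac12\|u-v\|^2$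 and $\tilde\nabla_x\Phi,\tilde\nabla_y\Phi$ are (jointly measurable) stochastic oracles. Assume that $\{\omega_k^x\}_{k\ge0}$ and $\{\omega_k^y\}_{k\ge-1}$ are sequences of independent random variables, independent of each other, and that, for some $\delta_x,\delta_y>0$, for all $k\ge 0$ (in the statements on $\omega_k^y$, for all $k\ge-1$), $$\mathbb E[\tilde\nabla_x\Phi(x_k,y_{k+1};\omega_k^x)\mid x_k,y_{k+1}]=\nabla_x\Phi(x_k,y_{k+1}),\qquad \mathbb E[\tilde\nabla_y\Phi(x_k,y_k;\omega_k^y)\mid x_k,y_k]=\nabla_y\Phi(x_k,y_k),$$ $$\mathbb E[\|\tilde\nabla_x\Phi(x_k,y_{k+1};\omega_k^x)-\nabla_x\Phi(x_k,y_{k+1})\|^2\mid x_k,y_{k+1}]\le\delta_x^2,\qquad \mathbb E[\|\tilde\nabla_y\Phi(x_k,y_k;\omega_k^y)-\nabla_y\Phi(x_k,y_k)\|^2\mid x_k,y_k]\le\delta_y^2$$ almost surely. Suppose that for some $\alpha\in[0,\frac1\sigma)$ and $\rho\in(0,1)$ the following matrix is positive semidefinite: $$\begin{pmatrix}\frac1\tau+\mu_x-\frac1{\rho\tau}&0&0&0&0\\0&\frac1\sigma+\mu_y-\frac1{\rho\sigma}&(\frac\theta\rho-1)L_{yx}&(\frac\theta\rho-1)L_{yy}&0\\0&(\frac\theta\rho-1)L_{yx}&\frac1\tau-L_{xx}&0&-\frac\theta\rho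 L_{yx}\\0&(\frac\theta\rho-1)L_{yy}&0&\frac1\sigma-\alpha&-\frac\theta\rho L_{yy}\\0&0&-\frac\theta\rho L_{yx}&-\frac\theta\rho L_{yy}&\frac\alpha\rho\end{pmatrix}\succeq0.$$ Then, for all $\eta_x,\eta_y>0$, $$\mathcal J:=\limsup_{N\to\infty}\mathbb E\Big[\tfrac1{\delta_x^2}\|x_N-x^*\|^2+\tfrac1{\delta_y^2}\|y_N-y^*\|^2\Big]\le\frac1{(1-\rho)\delta^2}\cdot\frac{\Xi_{\tau,\sigma,\theta}}{C_{\tau,\sigma}},$$ where $\delta=\min\{\delta_x,\delta_y\}$, $C_{\tau,\sigma}=\min\{\frac1{2\rho\tau},\frac{1-\alpha\sigma}{2\rho\sigma}\}$ and $$\Xi_{\tau,\sigma,\theta}=\Big(\tfrac{\tau}{1+\tau\mu_x}\Xi^x+\tfrac1{2\eta_x}\Big)\delta_x^2+\Big(\tfrac{\sigma}{1+\sigma\mu_y}\Xi^y+\tfrac{1+2\theta}{2\eta_y}\Big)\delta_y^2,\qquad \Xi^x=1+\tfrac{\sigma\theta(1+\theta)L_{yx}}{2(1+\sigma\mu_y)},$$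 $$\Xi^y=\Big(1+2\theta+\tfrac{\theta+\sigma\theta(1+\theta)L_{yy}}{1+\sigma\mu_y}+\tfrac{\tau\sigma\theta(1+\theta)L_{yx}L_{xy}}{(1+\tau\mu_x)(1+\sigma\mu_y)}\Big)(1+2\theta)+\tfrac{\tau\theta(1+\theta)L_{yx}}{2(1+\tau\mu_x)}.$$ -/

import Mathlib

open MeasureTheory ProbabilityTheory Filter
open scoped ENNReal Gradient

namespace SAPD

section Problem

variable {X Y : Type*}
  [NormedAddCommGroup X] [InnerProductSpace ℝ X] [CompleteSpace X]
  [NormedAddCommGroup Y] [InnerProductSpace ℝ Y] [CompleteSpace Y]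

/-- The effective domain of an extended-real-valued function. -/
def effDom {E : Type*} (f : E → EReal) : Set E := {x | f x < ⊤}

/-- `f : E → ℝ ∪ {∞}` is proper, closed (lower semicontinuous) and convex with modulus `μ ≥ 0`. -/
structure IsProperClosedConvex {E : Type*} [NormedAddCommGroup E] [InnerProductSpace ℝ E]
    (f : E → EReal) (μ : ℝ) : Prop where
  ne_bot : ∀ x, f x ≠ ⊥
  nonempty : (effDom f).Nonempty
  closed : LowerSemicontinuous f
  modulus_nonneg : 0 ≤ μ
  convex : StrongConvexOn (effDom f) μ (fun x => (f x).toReal)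

/-- The partial gradient `∇ₓ Φ(x, y)`. -/
noncomputable def gradX (Φ : X → Y → ℝ) (x : X) (y : Y) : X := ∇ (fun x' => Φ x' y) x

/-- The partial gradient `∇_y Φ(x, y)`. -/
noncomputable def gradY (Φ : X → Y → ℝ) (x : X) (y : Y) : Y := ∇ (fun y' => Φ x y') y

/-- The standing assumption on the data of `min_x max_y f(x) + Φ(x, y) - g(y)`. -/
structure ProblemAssumption (f : X → EReal) (g : Y → EReal) (Φ : X → Y → ℝ)
    (μx μy Lxx Lxy Lyx Lyy : ℝ) : Prop where
  f_convex : IsProperClosedConvex f μx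
  g_convex : IsProperClosedConvex g μy
  Lxx_nonneg : 0 ≤ Lxx
  Lxy_pos : 0 < Lxy
  Lyx_pos : 0 < Lyx
  Lyy_nonneg : 0 ≤ Lyy
  convex_x : ∀ y ∈ effDom g, ConvexOn ℝ Set.univ (fun x => Φ x y)
  differentiable_x : ∀ y ∈ effDom g, Differentiable ℝ (fun x => Φ x y)
  lipschitz_x : ∀ x ∈ effDom f, ∀ x' ∈ effDom f, ∀ y ∈ effDom g, ∀ y' ∈ effDom g,
    ‖gradX Φ x y - gradX Φ x' y'‖ ≤ Lxx * ‖x - x'‖ + Lxy * ‖y - y'‖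
  concave_y : ∀ x ∈ effDom f, ConcaveOn ℝ Set.univ (fun y => Φ x y)
  differentiable_y : ∀ x ∈ effDom f, Differentiable ℝ (fun y => Φ x y)
  lipschitz_y : ∀ x ∈ effDom f, ∀ x' ∈ effDom f, ∀ y ∈ effDom g, ∀ y' ∈ effDom g,
    ‖gradY Φ x y - gradY Φ x' y'‖ ≤ Lyx * ‖x - x'‖ + Lyy * ‖y - y'‖

/-- The objective `L(x, y) = f(x) + Φ(x, y) - g(y)`. -/
noncomputable def lagrangian (f : X → EReal) (g : Y → EReal) (Φ : X → Y → ℝ)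
    (x : X) (y : Y) : EReal :=
  f x + ((Φ x y : ℝ) : EReal) - g y

/-- `(xs, ys)` is a saddle point of the objective. As `xs` and `ys` lie in the effective domains,
no expression `∞ - ∞` occurs. -/
def IsSaddlePoint (f : X → EReal) (g : Y → EReal) (Φ : X → Y → ℝ) (xs : X) (ys : Y) : Prop :=
  xs ∈ effDom f ∧ ys ∈ effDom g ∧
    (∀ x, lagrangian f g Φ xs ys ≤ lagrangian f g Φ x ys) ∧
    (∀ y, lagrangian f g Φ xs y ≤ lagrangian f g Φ xs ys)

/-- `p = prox_{c f}(x)`, that is, `p` minimizes `v ↦ c f(v) + ‖x - v‖² / 2`. -/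
def IsProx {E : Type*} [NormedAddCommGroup E] (c : ℝ) (f : E → EReal) (x p : E) : Prop :=
  ∀ v, (c : EReal) * f p + ((‖x - p‖ ^ 2 / 2 : ℝ) : EReal) ≤
    (c : EReal) * f v + ((‖x - v‖ ^ 2 / 2 : ℝ) : EReal)

end Problem

section Algorithm

variable {X Y Ω Wx Wy : Type*}
  [NormedAddCommGroup X] [InnerProductSpace ℝ X] [CompleteSpace X]
  [NormedAddCommGroup Y] [InnerProductSpace ℝ Y] [CompleteSpace Y]

/-- The processes `x`, `y` are generated by the stochastic accelerated primal-dual algorithm from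
`(x₀, y₀)`, with stochastic oracles `Gx`, `Gy` for the partial gradients.

Indices: `ωx k` is the sample `ω_k^x`, for `k ≥ 0`. The samples `ω_k^y` are used for `k ≥ -1`, and
`ωy j` is `ω_{j-1}^y`. The truncated difference `k - 1` realizes `(x_{-1}, y_{-1}) = (x₀, y₀)`. -/
structure IsGenerated (f : X → EReal) (g : Y → EReal)
    (Gx : X → Y → Wx → X) (Gy : X → Y → Wy → Y) (ωx : ℕ → Ω → Wx) (ωy : ℕ → Ω → Wy)
    (τ σ θ : ℝ) (x₀ : X) (y₀ : Y) (x : ℕ → Ω → X) (y : ℕ → Ω → Y) : Prop where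
  x_zero : ∀ ω, x 0 ω = x₀
  y_zero : ∀ ω, y 0 ω = y₀
  y_step : ∀ k ω,
    IsProx σ g
      (y k ω + σ • (Gy (x k ω) (y k ω) (ωy (k + 1) ω) +
        θ • (Gy (x k ω) (y k ω) (ωy (k + 1) ω) - Gy (x (k - 1) ω) (y (k - 1) ω) (ωy k ω))))
      (y (k + 1) ω)
  x_step : ∀ k ω,
    IsProx τ f (x k ω - τ • Gx (x k ω) (y (k + 1) ω) (ωx k ω)) (x (k + 1) ω)

variable [MeasurableSpace X] [MeasurableSpace Y] [MeasurableSpace Wx] [MeasurableSpace Wy]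

/-- The assumption on the gradient noise: independent samples, unbiased oracles and conditional
variances at most `δx²`, `δy²`. The indices are as in `IsGenerated`; in the clauses on `Gy` the
index `j` stands for `k = j - 1 ≥ -1`. The integrability clauses say that the conditional
expectations exist. -/
structure NoiseAssumption [MeasurableSpace Ω] (P : Measure Ω) (Φ : X → Y → ℝ)
    (Gx : X → Y → Wx → X) (Gy : X → Y → Wy → Y) (ωx : ℕ → Ω → Wx) (ωy : ℕ → Ω → Wy)
    (δx δy : ℝ) (x : ℕ → Ω → X) (y : ℕ → Ω → Y) : Prop where
  measurable_Gx : Measurable (fun p : X × Y × Wx => Gx p.1 p.2.1 p.2.2)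
  measurable_Gy : Measurable (fun p : X × Y × Wy => Gy p.1 p.2.1 p.2.2)
  measurable_ωx : ∀ k, Measurable (ωx k)
  measurable_ωy : ∀ k, Measurable (ωy k)
  indep_x : iIndepFun ωx P
  indep_y : iIndepFun ωy P
  indep_xy : IndepFun (fun ω k => ωx k ω) (fun ω k => ωy k ω) P
  integrable_x : ∀ k, Integrable (fun ω => Gx (x k ω) (y (k + 1) ω) (ωx k ω)) P
  unbiased_x : ∀ k,
    P[fun ω => Gx (x k ω) (y (k + 1) ω) (ωx k ω) |
      MeasurableSpace.comap (fun ω => (x k ω, y (k + 1) ω)) inferInstance]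
      =ᵐ[P] fun ω => gradX Φ (x k ω) (y (k + 1) ω)
  integrable_y : ∀ j, Integrable (fun ω => Gy (x (j - 1) ω) (y (j - 1) ω) (ωy j ω)) P
  unbiased_y : ∀ j,
    P[fun ω => Gy (x (j - 1) ω) (y (j - 1) ω) (ωy j ω) |
      MeasurableSpace.comap (fun ω => (x (j - 1) ω, y (j - 1) ω)) inferInstance]
      =ᵐ[P] fun ω => gradY Φ (x (j - 1) ω) (y (j - 1) ω)
  sq_integrable_x : ∀ k, Integrable (fun ω =>
    ‖Gx (x k ω) (y (k + 1) ω) (ωx k ω) - gradX Φ (x k ω) (y (k + 1) ω)‖ ^ 2) P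
  variance_x : ∀ k,
    P[fun ω => ‖Gx (x k ω) (y (k + 1) ω) (ωx k ω) - gradX Φ (x k ω) (y (k + 1) ω)‖ ^ 2 |
      MeasurableSpace.comap (fun ω => (x k ω, y (k + 1) ω)) inferInstance]
      ≤ᵐ[P] fun _ => δx ^ 2
  sq_integrable_y : ∀ j, Integrable (fun ω =>
    ‖Gy (x (j - 1) ω) (y (j - 1) ω) (ωy j ω) - gradY Φ (x (j - 1) ω) (y (j - 1) ω)‖ ^ 2) P
  variance_y : ∀ j,
    P[fun ω =>
        ‖Gy (x (j - 1) ω) (y (j - 1) ω) (ωy j ω) - gradY Φ (x (j - 1) ω) (y (j - 1) ω)‖ ^ 2 |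
      MeasurableSpace.comap (fun ω => (x (j - 1) ω, y (j - 1) ω)) inferInstance]
      ≤ᵐ[P] fun _ => δy ^ 2

/-- `J_N = E[‖x_N - x*‖² / δx² + ‖y_N - y*‖² / δy²]`, with values in `[0, ∞]`. -/
noncomputable def normalizedVariance [MeasurableSpace Ω] (P : Measure Ω) (δx δy : ℝ)
    (xs : X) (ys : Y) (x : ℕ → Ω → X) (y : ℕ → Ω → Y) (N : ℕ) : ℝ≥0∞ :=
  ∫⁻ ω, ENNReal.ofReal (1 / δx ^ 2 * ‖x N ω - xs‖ ^ 2 + 1 / δy ^ 2 * ‖y N ω - ys‖ ^ 2) ∂P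

/-- The robustness measure `J = limsup_{N → ∞} J_N`. -/
noncomputable def robustness [MeasurableSpace Ω] (P : Measure Ω) (δx δy : ℝ)
    (xs : X) (ys : Y) (x : ℕ → Ω → X) (y : ℕ → Ω → Y) : ℝ≥0∞ :=
  limsup (normalizedVariance P δx δy xs ys x y) atTop

end Algorithm

/-- The matrix `G` of the step size condition `G ⪰ 0`. -/
noncomputable def lmiMatrix (μx μy Lxx Lyx Lyy τ σ θ α ρ : ℝ) : Matrix (Fin 5) (Fin 5) ℝ :=
  !![1 / τ + μx - 1 / (ρ * τ), 0, 0, 0, 0;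
     0, 1 / σ + μy - 1 / (ρ * σ), (θ / ρ - 1) * Lyx, (θ / ρ - 1) * Lyy, 0;
     0, (θ / ρ - 1) * Lyx, 1 / τ - Lxx, 0, -(θ / ρ) * Lyx;
     0, (θ / ρ - 1) * Lyy, 0, 1 / σ - α, -(θ / ρ) * Lyy;
     0, 0, -(θ / ρ) * Lyx, -(θ / ρ) * Lyy, α / ρ]

/-- The constant `Ξ^x`. -/
noncomputable def xiX (μy Lyx σ θ : ℝ) : ℝ :=
  1 + σ * θ * (1 + θ) * Lyx / (2 * (1 + σ * μy))

/-- The constant `Ξ^y`. -/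
noncomputable def xiY (μx μy Lxy Lyx Lyy τ σ θ : ℝ) : ℝ :=
  (1 + 2 * θ + (θ + σ * θ * (1 + θ) * Lyy) / (1 + σ * μy)
      + τ * σ * θ * (1 + θ) * Lyx * Lxy / ((1 + τ * μx) * (1 + σ * μy))) * (1 + 2 * θ)
    + τ * θ * (1 + θ) * Lyx / (2 * (1 + τ * μx))

/-- The variance constant `Ξ`, with the free parameters `ηx`, `ηy`. -/
noncomputable def xi (μx μy Lxy Lyx Lyy τ σ θ ηx ηy δx δy : ℝ) : ℝ :=
  (τ / (1 + τ * μx) * xiX μy Lyx σ θ + 1 / (2 * ηx)) * δx ^ 2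
    + (σ / (1 + σ * μy) * xiY μx μy Lxy Lyx Lyy τ σ θ + (1 + 2 * θ) / (2 * ηy)) * δy ^ 2

/-- The constant `C = min {1 / (2ρτ), (1 - ασ) / (2ρσ)}`. -/
noncomputable def cMin (τ σ α ρ : ℝ) : ℝ :=
  min (1 / (2 * ρ * τ)) (1 / (2 * ρ * σ) * (1 - α * σ))

end SAPD

/-! The proof is a drift inequality for the function `lyapunov`, which combines squared distances to
the saddle point, squared step lengths, and a cross term pairing the last gradient increment with
`ys - y`.

One step, with arbitrary gradient estimates: the strongly convex subgradient inequalities of the two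
proximal steps, the saddle inequality, convexity-concavity of `Φ` and the descent lemma bound the
next value of `lyapunov` by `lyapunovStep` plus products of gradient errors with new iterates
(`lyapunov_le_lyapunovStep_add_noise`). The matrix condition enters only through `lyapunovStep_le`,
which holds for every vector `v`. With `v` the dual increment it gives contraction by `ρ`; with `v =
y - ys` the cross terms cancel, and `lyapunov` dominates `cMin` times the squared distance to the
saddle point.

The new iterates depend on the same samples as the errors that multiply them, so these products need
not have mean zero. In `noise_le` each iterate is replaced by one computed with exact gradients,
hence determined before the sample in question; the product with the replacement has mean zero
(`integral_inner_eq_zero_of_indepFun`). The proximal map contracts by `1 / (1 + c μ)`, so the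
replacement costs only quadratic terms in the errors, whose expectation is at most `xi`. The
momentum term carries the error of the previous dual step, which has already influenced two dual
updates and one primal update; undoing all three produces the long coefficient in `xiY`.

In expectation this gives `a (n + 1) ≤ ρ * a n + xi`. Iterating bounds the limsup by `xi / (1 - ρ)`,
and division by `cMin` and the squared smaller noise level finishes the proof. -/

namespace SAPD

/-! ### Proximal points of strongly convex extended-real functions: existence, uniqueness,
contraction. -/

section Prox

variable {E : Type*} [NormedAddCommGroup E] [InnerProductSpace ℝ E]
  {f : E → EReal} {μ c : ℝ} {u u' p p' v : E}

lemma IsProperClosedConvex.coe_toReal (hf : IsProperClosedConvex f μ) (hv : v ∈ effDom f) :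
    ((f v).toReal : EReal) = f v :=
  EReal.coe_toReal (ne_of_lt hv) (hf.ne_bot v)

lemma coe_mul_add_of_mem (hf : IsProperClosedConvex f μ) (hv : v ∈ effDom f) (r : ℝ) :
    (c : EReal) * f v + (r : EReal) = ((c * (f v).toReal + r : ℝ) : EReal) := by
  rw [← hf.coe_toReal hv]; push_cast; simp

lemma IsProx.mem_effDom (hf : IsProperClosedConvex f μ) (hc : 0 < c) (h : IsProx c f u p) :
    p ∈ effDom f := by
  obtain ⟨v, hv⟩ := hf.nonempty
  by_contra hp
  have hp' : f p = ⊤ := by simpa [effDom] using hp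
  have := h v
  rw [coe_mul_add_of_mem hf hv, hp', EReal.coe_mul_top_of_pos hc, EReal.top_add_coe] at this
  exact absurd this (not_le.2 (EReal.coe_lt_top _))

lemma IsProx.real_le (hf : IsProperClosedConvex f μ) (hc : 0 < c) (h : IsProx c f u p)
    (hv : v ∈ effDom f) :
    c * (f p).toReal + ‖u - p‖ ^ 2 / 2 ≤ c * (f v).toReal + ‖u - v‖ ^ 2 / 2 := by
  have := h v
  rw [coe_mul_add_of_mem hf hv, coe_mul_add_of_mem hf (h.mem_effDom hf hc)] at this
  exact_mod_cast this

/-- This is the limit `t → 0`, used to discard second-order terms in variational arguments. -/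
lemma le_of_forall_le_add_mul {a b K : ℝ} (h : ∀ t : ℝ, 0 < t → t < 1 → a ≤ b + t * K) :
    a ≤ b := by
  by_contra! hab
  set t := min (1 / 2) ((a - b) / (2 * (|K| + 1))) with ht
  have hab' : 0 < a - b := sub_pos.2 hab
  have ht0 : 0 < t := lt_min (by norm_num) (by positivity)
  have ht1 : t ≤ 1 / 2 := min_le_left _ _
  have h1 : t * (|K| + 1) ≤ (a - b) / 2 := by
    calc t * (|K| + 1) ≤ (a - b) / (2 * (|K| + 1)) * (|K| + 1) := by
          gcongr; exact min_le_right _ _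
      _ = (a - b) / 2 := by field_simp
  have h2 : t * K ≤ t * |K| := by gcongr; exact le_abs_self K
  linarith [h t ht0 (by linarith)]

/-- The subgradient inequality that characterizes the proximal point. -/
lemma IsProx.subgradient (hf : IsProperClosedConvex f μ) (hc : 0 < c) (h : IsProx c f u p)
    (hv : v ∈ effDom f) :
    c * (f p).toReal + inner ℝ (u - p) (v - p) + c * μ / 2 * ‖v - p‖ ^ 2 ≤ c * (f v).toReal := by
  have hp := h.mem_effDom hf hc
  -- Compare `p` with the competitor `(1 - t) p + t v`, divide by `t` and let `t → 0`. The constant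
  -- `K` collects what is still of order `t` after the division: the defect in the strong convexity
  -- term and the square from the quadratic.
  refine le_of_forall_le_add_mul (K := c * μ / 2 * ‖v - p‖ ^ 2 + ‖v - p‖ ^ 2 / 2)
    fun t ht0 ht1 => ?_
  have hw := hf.convex.1 hp hv (sub_nonneg.2 ht1.le) ht0.le (by ring)
  have h1 := h.real_le hf hc hw
  have h2 := hf.convex.2 hp hv (sub_nonneg.2 ht1.le) ht0.le (by ring)
  have h3 : u - ((1 - t) • p + t • v) = (u - p) - t • (v - p) := by module
  rw [h3, norm_sub_sq_real (u - p), norm_smul, real_inner_smul_right, mul_pow, Real.norm_eq_abs,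
    sq_abs] at h1
  simp only [smul_eq_mul] at h2
  rw [norm_sub_rev p v] at h2
  have h4 := mul_le_mul_of_nonneg_left h2 hc.le
  have h5 : t * (c * (f p).toReal + inner ℝ (u - p) (v - p) + c * μ / 2 * ‖v - p‖ ^ 2) ≤
      t * (c * (f v).toReal + t * (c * μ / 2 * ‖v - p‖ ^ 2 + ‖v - p‖ ^ 2 / 2)) := by
    linarith
  exact le_of_mul_le_mul_left h5 ht0

/-- Strong monotonicity: test each subgradient inequality at the other proximal point and add. The
factor `1 / (1 + c * μ)` is the origin of the denominators in `xiX` and `xiY`. -/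
lemma IsProx.norm_sub_le (hf : IsProperClosedConvex f μ) (hc : 0 < c) (h : IsProx c f u p)
    (h' : IsProx c f u' p') : ‖p - p'‖ ≤ 1 / (1 + c * μ) * ‖u - u'‖ := by
  have hμ := hf.modulus_nonneg
  have h1 := h.subgradient hf hc (h'.mem_effDom hf hc)
  have h2 := h'.subgradient hf hc (h.mem_effDom hf hc)
  have h3 : inner ℝ (u - p) (p' - p) + inner ℝ (u' - p') (p - p') =
      ‖p - p'‖ ^ 2 - inner ℝ (u - u') (p - p') := by
    rw [← real_inner_self_eq_norm_sq, ← neg_sub p p', inner_neg_right]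
    simp only [inner_sub_left, inner_sub_right]; ring
  rw [norm_sub_rev p' p] at h1
  have h4 := real_inner_le_norm (u - u') (p - p')
  have h5 : ‖p - p'‖ * ((1 + c * μ) * ‖p - p'‖) ≤ ‖p - p'‖ * ‖u - u'‖ := by nlinarith
  have hpos : 0 < 1 + c * μ := by positivity
  rw [div_mul_eq_mul_div, one_mul, le_div_iff₀ hpos, mul_comm]
  rcases (norm_nonneg (p - p')).eq_or_lt with h0 | h0
  · rw [← h0]; simp
  · exact le_of_mul_le_mul_left h5 h0

/-- A substitute for an affine minorant, obtained without separation. On the compact unit ball about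
`v` lower semicontinuity gives a minimum `f m`. For `w` outside the ball, the point of the segment
from `v` to `w` at distance one from `v` has value at least `f m`, and convexity then limits how
fast `f` can decrease towards `w`; `K` is `f v - f m`. -/
lemma IsProperClosedConvex.exists_linear_lower_bound [FiniteDimensional ℝ E]
    (hf : IsProperClosedConvex f μ) (hv : v ∈ effDom f) :
    ∃ K : ℝ, 0 ≤ K ∧ ∀ w ∈ effDom f, (f v).toReal - K * (1 + ‖w - v‖) ≤ (f w).toReal := by
  obtain ⟨m, hm, hmin⟩ := (hf.closed.lowerSemicontinuousOn (Metric.closedBall v 1)).exists_isMinOn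
    ⟨v, by simp⟩ (isCompact_closedBall v 1)
  have hle : ∀ w ∈ Metric.closedBall v 1, f m ≤ f w := fun w hw => hmin hw
  have hmd : m ∈ effDom f := (hle v (by simp)).trans_lt hv
  have hr : ∀ w ∈ Metric.closedBall v 1, w ∈ effDom f → (f m).toReal ≤ (f w).toReal :=
    fun w hw hwd => EReal.toReal_le_toReal (hle w hw) (hf.ne_bot m) (ne_of_lt hwd)
  have hK := hr v (by simp) hv
  refine ⟨(f v).toReal - (f m).toReal, sub_nonneg.2 hK, fun w hw => ?_⟩
  have hμ := hf.modulus_nonneg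
  rcases le_or_gt ‖w - v‖ 1 with h1 | h1
  · have := hr w (by simpa [dist_eq_norm] using h1) hw
    nlinarith [norm_nonneg (w - v)]
  · set r := ‖w - v‖ with hrdef
    have hr0 : 0 < r := by linarith
    have ha : 0 ≤ 1 - 1 / r := by
      rw [sub_nonneg, div_le_one hr0]; exact h1.le
    have hb : 0 ≤ 1 / r := by positivity
    have hd := hf.convex.1 hv hw ha hb (by ring)
    have h2 := hf.convex.2 hv hw ha hb (by ring)
    have h3 := hr _ (by
      rw [mem_closedBall_iff_norm]
      have : (1 - 1 / r) • v + (1 / r) • w - v = (1 / r) • (w - v) := by module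
      rw [this, norm_smul, Real.norm_eq_abs, abs_of_nonneg hb, ← hrdef]
      field_simp; rfl) hd
    simp only [smul_eq_mul] at h2
    have h4 : 0 ≤ (1 - 1 / r) * (1 / r) * (μ / 2 * ‖v - w‖ ^ 2) := by positivity
    have h5 : (f m).toReal ≤ (1 - 1 / r) * (f v).toReal + 1 / r * (f w).toReal := by linarith
    have h6 := mul_le_mul_of_nonneg_left h5 hr0.le
    have h7 : r * ((1 - 1 / r) * (f v).toReal + 1 / r * (f w).toReal) =
      (r - 1) * (f v).toReal + (f w).toReal := by field_simp
    nlinarith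

/-- The quadratic beats the linear lower bound, so the minimum over a large ball is global.
Existence is needed because the noise argument takes proximal steps from points that the algorithm
never visits. -/
lemma IsProperClosedConvex.exists_isProx [FiniteDimensional ℝ E]
    (hf : IsProperClosedConvex f μ) (hc : 0 < c) (u : E) : ∃ p, IsProx c f u p := by
  obtain ⟨v, hv⟩ := hf.nonempty
  obtain ⟨K, hK0, hK⟩ := hf.exists_linear_lower_bound hv
  have hlsc : LowerSemicontinuous
      (fun w => (c : EReal) * f w + ((‖u - w‖ ^ 2 / 2 : ℝ) : EReal)) := by
    have h1 : LowerSemicontinuous (fun w => (c : EReal) * f w) := by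
      refine Continuous.comp_lowerSemicontinuous (g := fun z : EReal => (c : EReal) * z) ?_
        hf.closed ?_
      · exact continuous_iff_continuousAt.2 fun z =>
          (EReal.continuousAt_mul (p := ((c : EReal), z)) (by simp [hc.ne']) (by simp [hc.ne'])
            (by simp) (by simp)).comp (by fun_prop : ContinuousAt (fun z => ((c : EReal), z)) z)
      · intro a b hab
        exact mul_le_mul_of_nonneg_left hab (by exact_mod_cast hc.le)
    have h2 : Continuous (fun w => ((‖u - w‖ ^ 2 / 2 : ℝ) : EReal)) := by
      apply continuous_coe_real_ereal.comp; fun_prop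
    refine h1.add' h2.lowerSemicontinuous fun w => EReal.continuousAt_add ?_ ?_ <;> simp
  set d := ‖u - v‖ with hd
  -- The radius is chosen so that beyond it the gain in the quadratic exceeds `c * K * (1 + s + d)`,
  -- the largest possible decrease of `c * f` from its value at `v`.
  set R := 2 * c * K * (2 + d) + d + 1 with hR
  have hd0 : 0 ≤ d := norm_nonneg _
  have hcK : 0 ≤ 2 * c * K := by positivity
  have hvR : v ∈ Metric.closedBall u R := by
    rw [Metric.mem_closedBall, dist_comm, dist_eq_norm]; nlinarith
  obtain ⟨p, hp, hmin⟩ := (hlsc.lowerSemicontinuousOn (Metric.closedBall u R)).exists_isMinOn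
    ⟨v, hvR⟩ (isCompact_closedBall u R)
  refine ⟨p, fun w => ?_⟩
  by_cases hw : w ∈ Metric.closedBall u R
  · exact hmin hw
  refine (hmin hvR).trans ?_
  by_cases hwd : w ∈ effDom f
  · simp only
    rw [coe_mul_add_of_mem hf hwd, coe_mul_add_of_mem hf hv, EReal.coe_le_coe_iff]
    have h1 := hK w hwd
    rw [Metric.mem_closedBall, dist_comm, dist_eq_norm, not_le] at hw
    have h2 : ‖w - v‖ ≤ ‖u - w‖ + d := by
      rw [hd, ← norm_neg (u - w)]
      calc ‖w - v‖ = ‖-(u - w) + (u - v)‖ := by congr 1; abel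
        _ ≤ _ := norm_add_le _ _
    set s := ‖u - w‖
    have h3 : K * (1 + ‖w - v‖) ≤ K * (1 + s + d) :=
      mul_le_mul_of_nonneg_left (by linarith) hK0
    have h4 : c * ((f v).toReal - K * (1 + s + d)) ≤ c * (f w).toReal := by
      gcongr; linarith
    have h5 : 1 ≤ s := by linarith [mul_nonneg hcK (by linarith : 0 ≤ 2 + d)]
    have h6 : s * R ≤ s * s := by gcongr
    have h7 : d * d ≤ s * d := by
      have : d ≤ s := by linarith [mul_nonneg hcK (by linarith : 0 ≤ 2 + d)]
      gcongr
    have h8 : (2 * c * K * (1 + d)) * 1 ≤ (2 * c * K * (1 + d)) * s := by gcongr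
    nlinarith
  · have hwd' : f w = ⊤ := by simpa [effDom] using hwd
    rw [hwd', EReal.coe_mul_top_of_pos hc, EReal.top_add_coe]
    exact le_top

/-- The proximal map `prox_{c f}`. -/
noncomputable def proxMap (c : ℝ) (f : E → EReal) (u : E) : E :=
  Classical.epsilon fun p => IsProx c f u p

variable [FiniteDimensional ℝ E]

lemma isProx_proxMap (hf : IsProperClosedConvex f μ) (hc : 0 < c) (u : E) :
    IsProx c f u (proxMap c f u) :=
  Classical.epsilon_spec (hf.exists_isProx hc u)

lemma proxMap_mem (hf : IsProperClosedConvex f μ) (hc : 0 < c) (u : E) :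
    proxMap c f u ∈ effDom f :=
  (isProx_proxMap hf hc u).mem_effDom hf hc

lemma norm_proxMap_sub_le (hf : IsProperClosedConvex f μ) (hc : 0 < c) (u u' : E) :
    ‖proxMap c f u - proxMap c f u'‖ ≤ 1 / (1 + c * μ) * ‖u - u'‖ :=
  (isProx_proxMap hf hc u).norm_sub_le hf hc (isProx_proxMap hf hc u')

lemma IsProx.eq_proxMap (hf : IsProperClosedConvex f μ) (hc : 0 < c) (h : IsProx c f u p) :
    p = proxMap c f u := by
  have := h.norm_sub_le hf hc (isProx_proxMap hf hc u)
  simpa [sub_eq_zero] using this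

lemma norm_proxMap_sub_le' (hf : IsProperClosedConvex f μ) (hc : 0 < c) (u u' : E) :
    ‖proxMap c f u - proxMap c f u'‖ ≤ ‖u - u'‖ := by
  have hμ := hf.modulus_nonneg
  refine (norm_proxMap_sub_le hf hc u u').trans (mul_le_of_le_one_left (norm_nonneg _) ?_)
  rw [div_le_one (by positivity)]
  nlinarith [mul_nonneg hc.le hμ]

lemma continuous_proxMap (hf : IsProperClosedConvex f μ) (hc : 0 < c) :
    Continuous (proxMap c f) := by
  refine (LipschitzWith.of_dist_le_mul (K := 1) fun a b => ?_).continuous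
  simpa [dist_eq_norm] using norm_proxMap_sub_le' hf hc a b

end Prox

/-! ### First-order inequalities along segments. -/

section Gradient

variable {E : Type*} [NormedAddCommGroup E] [InnerProductSpace ℝ E] [CompleteSpace E]
  {φ : E → ℝ}

lemma hasDerivAt_line (hφ : Differentiable ℝ φ) (a d : E) (t : ℝ) :
    HasDerivAt (fun t : ℝ => φ (a + t • d)) (inner ℝ (∇ φ (a + t • d)) d) t := by
  have h1 := (hφ (a + t • d)).hasGradientAt.hasFDerivAt
  have h2 : HasDerivAt (fun t : ℝ => a + t • d) d t := by
    simpa using ((hasDerivAt_id t).smul_const d).const_add a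
  exact h1.comp_hasDerivAt t h2

lemma inner_gradient_le_of_convexOn (hφ : Differentiable ℝ φ) (hc : ConvexOn ℝ Set.univ φ)
    (a b : E) : φ a + inner ℝ (∇ φ a) (b - a) ≤ φ b := by
  have h := hasDerivAt_line hφ a (b - a) 0
  have hc' : ConvexOn ℝ Set.univ (fun t : ℝ => φ (a + t • (b - a))) := by
    have := hc.comp_affineMap (AffineMap.lineMap a b)
    simpa [Function.comp_def, AffineMap.lineMap_apply, add_comm] using this
  have := hc'.le_slope_of_hasDerivAt (Set.mem_univ 0) (Set.mem_univ 1) one_pos h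
  simp only [slope_def_field, zero_smul, one_smul, add_zero, add_sub_cancel, sub_zero,
    div_one] at this
  linarith

/-- The descent lemma on a segment along which the gradient is Lipschitz from its start. -/
lemma le_quadratic_of_gradient_lipschitz (hφ : Differentiable ℝ φ) {a b : E} {L : ℝ}
    (hL : ∀ t ∈ Set.Icc (0 : ℝ) 1,
      ‖∇ φ (a + t • (b - a)) - ∇ φ a‖ ≤ L * ‖t • (b - a)‖) :
    φ b ≤ φ a + inner ℝ (∇ φ a) (b - a) + L / 2 * ‖b - a‖ ^ 2 := by
  set d := b - a with hd
  -- The claim is `ψ 1 ≤ ψ 0`; the Lipschitz hypothesis makes the derivative of `ψ` nonpositive on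
  -- the open interval.
  set ψ : ℝ → ℝ := fun t => φ (a + t • d) - t * inner ℝ (∇ φ a) d - L / 2 * ‖d‖ ^ 2 * t ^ 2
  have hψ : ∀ t, HasDerivAt ψ
      (inner ℝ (∇ φ (a + t • d)) d - inner ℝ (∇ φ a) d - L * ‖d‖ ^ 2 * t) t := by
    intro t
    have h1 := hasDerivAt_line hφ a d t
    have h2 := (hasDerivAt_id t).mul_const (inner ℝ (∇ φ a) d)
    have h3 := (hasDerivAt_pow 2 t).const_mul (L / 2 * ‖d‖ ^ 2)
    refine ((h1.sub h2).sub h3).congr_deriv ?_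
    push_cast; ring
  have hanti : AntitoneOn ψ (Set.Icc 0 1) := by
    refine antitoneOn_of_deriv_nonpos (convex_Icc 0 1)
      (fun t _ => (hψ t).continuousAt.continuousWithinAt)
      (fun t _ => (hψ t).differentiableAt.differentiableWithinAt) fun t ht => ?_
    rw [interior_Icc] at ht
    rw [(hψ t).deriv, ← inner_sub_left]
    have h1 := hL t ⟨ht.1.le, ht.2.le⟩
    have h2 := real_inner_le_norm (∇ φ (a + t • d) - ∇ φ a) d
    rw [norm_smul, Real.norm_eq_abs, abs_of_pos ht.1] at h1
    nlinarith [norm_nonneg d, mul_le_mul_of_nonneg_right h1 (norm_nonneg d)]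
  have := hanti (Set.left_mem_Icc.2 zero_le_one) (Set.right_mem_Icc.2 zero_le_one) zero_le_one
  simp only [ψ, zero_smul, one_smul, add_zero, hd, add_sub_cancel] at this
  linarith

end Gradient

/-! ### Deterministic analysis of one step. -/

section OneStep

variable {X Y : Type*}
  [NormedAddCommGroup X] [InnerProductSpace ℝ X] [CompleteSpace X]
  [NormedAddCommGroup Y] [InnerProductSpace ℝ Y] [CompleteSpace Y]
  {f : X → EReal} {g : Y → EReal} {Φ : X → Y → ℝ} {μx μy Lxx Lxy Lyx Lyy : ℝ}
  {xs : X} {ys : Y} {τ σ θ α ρ : ℝ}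

/-- The Lyapunov function of the algorithm, evaluated at `(x, y)` with preceding iterate
`(x', y')`. -/
noncomputable def lyapunov (Φ : X → Y → ℝ) (μx μy Lxx τ σ α : ℝ) (xs : X) (ys : Y)
    (x x' : X) (y y' : Y) : ℝ :=
  (1 / τ + μx) / 2 * ‖x - xs‖ ^ 2 + (1 / σ + μy) / 2 * ‖y - ys‖ ^ 2
    - inner ℝ (gradY Φ x y - gradY Φ x' y') (ys - y)
    + (1 / τ - Lxx) / 2 * ‖x - x'‖ ^ 2 + (1 / σ - α) / 2 * ‖y - y'‖ ^ 2

/-- The quantity that bounds the next value of the Lyapunov function up to gradient noise. -/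
noncomputable def lyapunovStep (Φ : X → Y → ℝ) (τ σ θ α : ℝ) (xs : X) (ys : Y)
    (x x' : X) (y y' v : Y) : ℝ :=
  1 / (2 * τ) * ‖x - xs‖ ^ 2 + 1 / (2 * σ) * ‖y - ys‖ ^ 2
    - θ * inner ℝ (gradY Φ x y - gradY Φ x' y') (ys - y)
    - θ * inner ℝ (gradY Φ x y - gradY Φ x' y') v - α / 2 * ‖v‖ ^ 2

lemma lmi_quadratic_nonneg (hG : (lmiMatrix μx μy Lxx Lyx Lyy τ σ θ α ρ).PosSemidef)
    (a b c d e : ℝ) :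
    0 ≤ (1 / τ + μx - 1 / (ρ * τ)) * a ^ 2 + (1 / σ + μy - 1 / (ρ * σ)) * b ^ 2
      + 2 * ((θ / ρ - 1) * b * (Lyx * c + Lyy * d)) + (1 / τ - Lxx) * c ^ 2
      + (1 / σ - α) * d ^ 2 - 2 * (θ / ρ * e * (Lyx * c + Lyy * d)) + α / ρ * e ^ 2 := by
  have h := hG.dotProduct_mulVec_nonneg ![a, b, c, d, e]
  simp [dotProduct, Matrix.mulVec, lmiMatrix, Fin.sum_univ_five] at h
  linear_combination h

/-- Cauchy-Schwarz and the Lipschitz bound on `gradY` replace every inner product by a product of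
norms. What is left is the quadratic form of the matrix at the vector of these norms. -/
lemma lyapunovStep_le (hprob : ProblemAssumption f g Φ μx μy Lxx Lxy Lyx Lyy)
    (hG : (lmiMatrix μx μy Lxx Lyx Lyy τ σ θ α ρ).PosSemidef) (hρ : 0 < ρ) (hθ : 0 ≤ θ)
    {x x' : X} {y y' : Y} (hx : x ∈ effDom f) (hx' : x' ∈ effDom f) (hy : y ∈ effDom g)
    (hy' : y' ∈ effDom g) (v : Y) :
    lyapunovStep Φ τ σ θ α xs ys x x' y y' v ≤
      ρ * lyapunov Φ μx μy Lxx τ σ α xs ys x x' y y' := by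
  have hq := hprob.lipschitz_y x hx x' hx' y hy y' hy'
  rw [lyapunovStep, lyapunov]
  set q := gradY Φ x y - gradY Φ x' y'
  set c := ‖x - x'‖
  set d := ‖y - y'‖
  have hLyx := hprob.Lyx_pos.le
  have hLyy := hprob.Lyy_nonneg
  have hv : θ / ρ * |inner ℝ q v| ≤ θ / ρ * ‖v‖ * (Lyx * c + Lyy * d) := by
    rw [mul_assoc]
    refine mul_le_mul_of_nonneg_left ?_ (by positivity)
    rw [mul_comm]
    exact (abs_real_inner_le_norm q v).trans (by gcongr)
  have hi : |inner ℝ q (ys - y)| ≤ ‖y - ys‖ * (Lyx * c + Lyy * d) := by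
    rw [mul_comm, norm_sub_rev y]
    exact (abs_real_inner_le_norm q _).trans (by gcongr)
  have key : (θ / ρ - 1) * inner ℝ q (ys - y) ≥
      -(|θ / ρ - 1| * (‖y - ys‖ * (Lyx * c + Lyy * d))) := by
    have := mul_le_mul_of_nonneg_left hi (abs_nonneg (θ / ρ - 1))
    rw [← abs_mul] at this
    linarith [neg_abs_le ((θ / ρ - 1) * inner ℝ q (ys - y))]
  have hv' : -(θ / ρ * ‖v‖ * (Lyx * c + Lyy * d)) ≤ θ / ρ * inner ℝ q v := by
    have := mul_le_mul_of_nonneg_left (neg_abs_le (inner ℝ q v)) (by positivity : 0 ≤ θ / ρ)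
    linarith
  have hquad : 0 ≤ (1 / τ + μx - 1 / (ρ * τ)) * ‖x - xs‖ ^ 2
      + (1 / σ + μy - 1 / (ρ * σ)) * ‖y - ys‖ ^ 2
      - 2 * (|θ / ρ - 1| * (‖y - ys‖ * (Lyx * c + Lyy * d))) + (1 / τ - Lxx) * c ^ 2
      + (1 / σ - α) * d ^ 2 - 2 * (θ / ρ * ‖v‖ * (Lyx * c + Lyy * d)) + α / ρ * ‖v‖ ^ 2 := by
    -- The sign of `θ / ρ - 1` is unknown. Since the second coordinate occurs linearly only with
    -- this factor, flipping its sign gives the cross term its worst sign in both cases.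
    rcases abs_cases (θ / ρ - 1) with ⟨h, -⟩ | ⟨h, -⟩
    · have := lmi_quadratic_nonneg hG ‖x - xs‖ (-‖y - ys‖) c d ‖v‖
      rw [h]; convert this using 1; ring
    · have := lmi_quadratic_nonneg hG ‖x - xs‖ ‖y - ys‖ c d ‖v‖
      rw [h]; convert this using 1; ring
  have hfin : 0 ≤ (1 / τ + μx - 1 / (ρ * τ)) * ‖x - xs‖ ^ 2
      + (1 / σ + μy - 1 / (ρ * σ)) * ‖y - ys‖ ^ 2
      + 2 * ((θ / ρ - 1) * inner ℝ q (ys - y)) + (1 / τ - Lxx) * c ^ 2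
      + (1 / σ - α) * d ^ 2 + 2 * (θ / ρ * inner ℝ q v) + α / ρ * ‖v‖ ^ 2 := by linarith
  have := mul_nonneg hρ.le hfin
  have e : ρ * ((1 / τ + μx - 1 / (ρ * τ)) * ‖x - xs‖ ^ 2
      + (1 / σ + μy - 1 / (ρ * σ)) * ‖y - ys‖ ^ 2
      + 2 * ((θ / ρ - 1) * inner ℝ q (ys - y)) + (1 / τ - Lxx) * c ^ 2
      + (1 / σ - α) * d ^ 2 + 2 * (θ / ρ * inner ℝ q v) + α / ρ * ‖v‖ ^ 2) =
      ρ * (1 / τ + μx) * ‖x - xs‖ ^ 2 - 1 / τ * ‖x - xs‖ ^ 2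
      + ρ * (1 / σ + μy) * ‖y - ys‖ ^ 2 - 1 / σ * ‖y - ys‖ ^ 2
      + 2 * ((θ - ρ) * inner ℝ q (ys - y)) + ρ * (1 / τ - Lxx) * c ^ 2
      + ρ * (1 / σ - α) * d ^ 2 + 2 * (θ * inner ℝ q v) + α * ‖v‖ ^ 2 := by
    have e1 : ρ * (1 / (ρ * τ)) = 1 / τ := by field_simp
    have e2 : ρ * (1 / (ρ * σ)) = 1 / σ := by field_simp
    have e3 : ρ * (θ / ρ) = θ := by field_simp
    have e4 : ρ * (α / ρ) = α := by field_simp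
    linear_combination (-‖x - xs‖ ^ 2) * e1 - ‖y - ys‖ ^ 2 * e2
      + (2 * inner ℝ q (ys - y) + 2 * inner ℝ q v) * e3 + ‖v‖ ^ 2 * e4
  rw [e] at this
  have e5 : 1 / (2 * τ) = 1 / τ / 2 := by ring
  have e6 : 1 / (2 * σ) = 1 / σ / 2 := by ring
  rw [e5, e6]
  linarith

/-- With `v = y - ys` in `lyapunovStep_le` the two inner products cancel, leaving only squares on
the left; dividing by `ρ` gives the constants in `cMin`. -/
lemma cMin_mul_le_lyapunov (hprob : ProblemAssumption f g Φ μx μy Lxx Lxy Lyx Lyy)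
    (hG : (lmiMatrix μx μy Lxx Lyx Lyy τ σ θ α ρ).PosSemidef) (hρ : 0 < ρ) (hθ : 0 ≤ θ)
    (hσ : 0 < σ)
    {x x' : X} {y y' : Y} (hx : x ∈ effDom f) (hx' : x' ∈ effDom f) (hy : y ∈ effDom g)
    (hy' : y' ∈ effDom g) :
    cMin τ σ α ρ * (‖x - xs‖ ^ 2 + ‖y - ys‖ ^ 2) ≤
      lyapunov Φ μx μy Lxx τ σ α xs ys x x' y y' := by
  have h := lyapunovStep_le (xs := xs) (ys := ys) hprob hG hρ hθ hx hx' hy hy' (-(ys - y))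
  rw [lyapunovStep, inner_neg_right, norm_neg, norm_sub_rev ys y] at h
  have h1 : cMin τ σ α ρ * ‖x - xs‖ ^ 2 ≤ 1 / (2 * ρ * τ) * ‖x - xs‖ ^ 2 :=
    mul_le_mul_of_nonneg_right (min_le_left _ _) (by positivity)
  have h2 : cMin τ σ α ρ * ‖y - ys‖ ^ 2 ≤ 1 / (2 * ρ * σ) * (1 - α * σ) * ‖y - ys‖ ^ 2 :=
    mul_le_mul_of_nonneg_right (min_le_right _ _) (by positivity)
  refine le_of_mul_le_mul_left (le_trans ?_ h) hρ
  have e1 : ρ * (1 / (2 * ρ * τ)) = 1 / (2 * τ) := by field_simp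
  have e2 : ρ * (1 / (2 * ρ * σ) * (1 - α * σ)) = 1 / (2 * σ) - α / 2 := by field_simp
  have h3 := mul_le_mul_of_nonneg_left (add_le_add h1 h2) hρ.le
  have e3 : ρ * (1 / (2 * ρ * τ) * ‖x - xs‖ ^ 2 +
      1 / (2 * ρ * σ) * (1 - α * σ) * ‖y - ys‖ ^ 2) =
      1 / (2 * τ) * ‖x - xs‖ ^ 2 + (1 / (2 * σ) - α / 2) * ‖y - ys‖ ^ 2 := by
    rw [← e1, ← e2]; ring
  linarith

lemma saddle_real_le (hprob : ProblemAssumption f g Φ μx μy Lxx Lxy Lyx Lyy)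
    (hsaddle : IsSaddlePoint f g Φ xs ys) {x : X} {y : Y} (hx : x ∈ effDom f)
    (hy : y ∈ effDom g) :
    (f xs).toReal + Φ xs y - (g y).toReal ≤ (f x).toReal + Φ x ys - (g ys).toReal := by
  obtain ⟨hxs, hys, h1, h2⟩ := hsaddle
  have h := (h2 y).trans (h1 x)
  rw [lagrangian, lagrangian, ← hprob.f_convex.coe_toReal hxs, ← hprob.f_convex.coe_toReal hx,
    ← hprob.g_convex.coe_toReal hys, ← hprob.g_convex.coe_toReal hy] at h
  exact_mod_cast h

/-- The coupling part of one step of the algorithm. -/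
lemma coupling_le (hprob : ProblemAssumption f g Φ μx μy Lxx Lxy Lyx Lyy)
    {x x₁ xs : X} {y₁ ys : Y} (hx : x ∈ effDom f) (hx₁ : x₁ ∈ effDom f) (hy₁ : y₁ ∈ effDom g) :
    Φ x₁ ys - Φ xs y₁ ≤ inner ℝ (gradY Φ x₁ y₁) (ys - y₁)
      + inner ℝ (gradX Φ x y₁) (x₁ - xs) + Lxx / 2 * ‖x₁ - x‖ ^ 2 := by
  have h1 : Φ x y₁ + inner ℝ (gradX Φ x y₁) (xs - x) ≤ Φ xs y₁ :=
    inner_gradient_le_of_convexOn (hprob.differentiable_x y₁ hy₁) (hprob.convex_x y₁ hy₁) x xs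
  have h2 : Φ x₁ y₁ ≤ Φ x y₁ + inner ℝ (gradX Φ x y₁) (x₁ - x) + Lxx / 2 * ‖x₁ - x‖ ^ 2 := by
    refine le_quadratic_of_gradient_lipschitz (hprob.differentiable_x y₁ hy₁) fun t ht => ?_
    -- The gradient is Lipschitz only between points of `effDom f`; convexity of the domain keeps
    -- the whole segment inside.
    have hmem : x + t • (x₁ - x) ∈ effDom f :=
      hprob.f_convex.convex.1.add_smul_sub_mem hx hx₁ ht
    simpa [gradX] using hprob.lipschitz_x _ hmem x hx y₁ hy₁ y₁ hy₁
  have h3 : Φ x₁ ys ≤ Φ x₁ y₁ + inner ℝ (gradY Φ x₁ y₁) (ys - y₁) := by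
    have hd := hprob.differentiable_y x₁ hx₁
    have := inner_gradient_le_of_convexOn hd.neg (hprob.concave_y x₁ hx₁).neg y₁ ys
    have hg : ∇ (-fun y' => Φ x₁ y') y₁ = -gradY Φ x₁ y₁ := by
      refine HasGradientAt.gradient ?_
      have := (hd y₁).hasGradientAt.hasFDerivAt.neg
      rw [hasGradientAt_iff_hasFDerivAt, map_neg]
      exact this
    rw [hg, inner_neg_left] at this
    simp only [Pi.neg_apply] at this
    linarith
  have e : inner ℝ (gradX Φ x y₁) (x₁ - x) - inner ℝ (gradX Φ x y₁) (xs - x) =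
      inner ℝ (gradX Φ x y₁) (x₁ - xs) := by
    rw [← inner_sub_right]; congr 1; abel
  linarith

/-- Polarization turns the inner product `(u - p, v - p)` in the subgradient inequality into three
squares. -/
lemma IsProx.three_point {E : Type*} [NormedAddCommGroup E] [InnerProductSpace ℝ E]
    {f : E → EReal} {μ c : ℝ} {u p v s : E} (hf : IsProperClosedConvex f μ) (hc : 0 < c)
    (h : IsProx c f (u + c • s) p) (hv : v ∈ effDom f) :
    (f p).toReal - (f v).toReal ≤ inner ℝ s (p - v) + 1 / (2 * c) * ‖u - v‖ ^ 2
      - (1 / c + μ) / 2 * ‖p - v‖ ^ 2 - 1 / (2 * c) * ‖p - u‖ ^ 2 := by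
  have h1 := h.subgradient hf hc hv
  have e1 : u + c • s - p = (u - p) + c • s := by abel
  have e2 : inner ℝ (u - p) (v - p) = (‖p - u‖ ^ 2 + ‖p - v‖ ^ 2 - ‖u - v‖ ^ 2) / 2 := by
    have := norm_sub_sq_real (u - p) (v - p)
    rw [sub_sub_sub_cancel_right, norm_sub_rev u p, norm_sub_rev v p] at this
    linarith
  have e3 : inner ℝ s (v - p) = -inner ℝ s (p - v) := by rw [← inner_neg_right, neg_sub]
  rw [e1, inner_add_left, real_inner_smul_left, e2, e3, norm_sub_rev v p] at h1
  refine le_of_mul_le_mul_left ?_ hc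
  have e4 : c * (inner ℝ s (p - v) + 1 / (2 * c) * ‖u - v‖ ^ 2
      - (1 / c + μ) / 2 * ‖p - v‖ ^ 2 - 1 / (2 * c) * ‖p - u‖ ^ 2) =
      c * inner ℝ s (p - v) + ‖u - v‖ ^ 2 / 2 - (1 + c * μ) / 2 * ‖p - v‖ ^ 2
        - ‖p - u‖ ^ 2 / 2 := by field_simp
  rw [e4]
  linarith

/-- One step of the algorithm with arbitrary gradient estimates `s`, `w`. -/
lemma lyapunov_le_lyapunovStep_add_noise
    (hprob : ProblemAssumption f g Φ μx μy Lxx Lxy Lyx Lyy)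
    (hsaddle : IsSaddlePoint f g Φ xs ys) (hτ : 0 < τ) (hσ : 0 < σ)
    {x x' x₁ w : X} {y y' y₁ s : Y} (hx : x ∈ effDom f)
    (hy₁ : IsProx σ g (y + σ • s) y₁) (hx₁ : IsProx τ f (x - τ • w) x₁) :
    lyapunov Φ μx μy Lxx τ σ α xs ys x₁ x y₁ y ≤
      lyapunovStep Φ τ σ θ α xs ys x x' y y' (y - y₁)
      + inner ℝ (s - (gradY Φ x y + θ • (gradY Φ x y - gradY Φ x' y'))) (y₁ - ys)
      - inner ℝ (w - gradX Φ x y₁) (x₁ - xs) := by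
  have hmx := hx₁.mem_effDom hprob.f_convex hτ
  have hmy := hy₁.mem_effDom hprob.g_convex hσ
  have h1 := hy₁.three_point hprob.g_convex hσ hsaddle.2.1
  rw [sub_eq_add_neg, ← smul_neg] at hx₁
  have h2 := hx₁.three_point hprob.f_convex hτ hsaddle.1
  have h3 := saddle_real_le hprob hsaddle hmx hmy
  have h4 := coupling_le (xs := xs) (ys := ys) hprob hx hmx hmy
  rw [lyapunov, lyapunovStep]
  set q := gradY Φ x y - gradY Φ x' y'
  rw [norm_sub_rev y y₁]
  -- The momentum product with `y₁ - ys` is split at `y`: one part is the old cross term of the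
  -- Lyapunov function, the other pairs `q` with the dual increment, which is the `v` of
  -- `lyapunovStep`.
  have e1 : inner ℝ (s - (gradY Φ x y + θ • q)) (y₁ - ys) =
      inner ℝ s (y₁ - ys) + inner ℝ (gradY Φ x y) (ys - y₁) + θ * inner ℝ q (ys - y)
        + θ * inner ℝ q (y - y₁) := by
    simp only [inner_sub_left, inner_add_left, inner_sub_right, real_inner_smul_left]
    ring
  have e2 : inner ℝ (w - gradX Φ x y₁) (x₁ - xs) =
      inner ℝ w (x₁ - xs) - inner ℝ (gradX Φ x y₁) (x₁ - xs) := inner_sub_left _ _ _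
  have e3 : inner ℝ (gradY Φ x₁ y₁ - gradY Φ x y) (ys - y₁) =
      inner ℝ (gradY Φ x₁ y₁) (ys - y₁) - inner ℝ (gradY Φ x y) (ys - y₁) := inner_sub_left _ _ _
  rw [inner_neg_left] at h2
  rw [e1, e2, e3]
  have e5 : 1 / (2 * τ) = 1 / τ / 2 := by ring
  have e6 : 1 / (2 * σ) = 1 / σ / 2 := by ring
  rw [e5] at h2 ⊢
  rw [e6] at h1 ⊢
  linarith

end OneStep

/-! ### Decoupling the gradient errors from the iterates. -/

section NoiseSplit

variable {X Y : Type*}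
  [NormedAddCommGroup X] [InnerProductSpace ℝ X] [CompleteSpace X]
  [NormedAddCommGroup Y] [InnerProductSpace ℝ Y] [CompleteSpace Y]
  {f : X → EReal} {g : Y → EReal} {Φ : X → Y → ℝ} {μx μy Lxx Lxy Lyx Lyy : ℝ}
  {xs : X} {ys : Y} {τ σ θ α ρ : ℝ}

/-- The dual step from `(x, y)` with the exact gradient at `(x, y)` and the estimate `w` of the
preceding gradient. -/
noncomputable def exactDualStep (Φ : X → Y → ℝ) (g : Y → EReal) (σ θ : ℝ) (w : Y) (x : X) (y : Y) :
    Y :=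
  proxMap σ g (y + σ • (gradY Φ x y + θ • (gradY Φ x y - w)))

/-- The primal step from `x` with the exact gradient at `(x, y)`. -/
noncomputable def exactPrimalStep (Φ : X → Y → ℝ) (f : X → EReal) (τ : ℝ) (x : X) (y : Y) : X :=
  proxMap τ f (x - τ • gradX Φ x y)

lemma inner_le_inner_add_norm_mul {E : Type*} [NormedAddCommGroup E] [InnerProductSpace ℝ E]
    (d a b c : E) : inner ℝ d (a - c) ≤ inner ℝ d (b - c) + ‖d‖ * ‖a - b‖ := by
  have h := real_inner_le_norm d (a - b)
  have e : inner ℝ d (a - c) = inner ℝ d (b - c) + inner ℝ d (a - b) := by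
    rw [← inner_add_right]; congr 1; abel
  linarith

lemma neg_inner_le_neg_inner_add_norm_mul {E : Type*} [NormedAddCommGroup E]
    [InnerProductSpace ℝ E] (d a b c : E) :
    -inner ℝ d (a - c) ≤ -inner ℝ d (b - c) + ‖d‖ * ‖a - b‖ := by
  have h := inner_le_inner_add_norm_mul (-d) a b c
  rwa [inner_neg_left, inner_neg_left, norm_neg] at h

/-- The two proximal arguments differ only by the current error, which enters with weight `1 + θ`
because the momentum uses the current estimate as well. -/
lemma norm_sub_exactDualStep_le [FiniteDimensional ℝ Y]
    (hprob : ProblemAssumption f g Φ μx μy Lxx Lxy Lyx Lyy)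
    (hσ : 0 < σ) (hθ : 0 ≤ θ) {x : X} {y y₁ w v : Y}
    (hy₁ : IsProx σ g (y + σ • (v + θ • (v - w))) y₁) :
    ‖y₁ - exactDualStep Φ g σ θ w x y‖ ≤
      1 / (1 + σ * μy) * (σ * (1 + θ) * ‖v - gradY Φ x y‖) := by
  rw [hy₁.eq_proxMap hprob.g_convex hσ, exactDualStep]
  refine (norm_proxMap_sub_le hprob.g_convex hσ _ _).trans_eq ?_
  have e : y + σ • (v + θ • (v - w)) - (y + σ • (gradY Φ x y + θ • (gradY Φ x y - w))) =
      (σ * (1 + θ)) • (v - gradY Φ x y) := by module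
  rw [e, norm_smul, Real.norm_of_nonneg (by positivity)]

/-- The exact step may use a dual point `y'` other than `y`, at a cost proportional to `Lxy`. This
is needed when the dual point has itself been replaced by an exact step. -/
lemma norm_sub_exactPrimalStep_le [FiniteDimensional ℝ X]
    (hprob : ProblemAssumption f g Φ μx μy Lxx Lxy Lyx Lyy)
    (hτ : 0 < τ) {x x₁ w : X} {y y' : Y} (hx : x ∈ effDom f) (hy : y ∈ effDom g)
    (hy' : y' ∈ effDom g) (hx₁ : IsProx τ f (x - τ • w) x₁) :
    ‖x₁ - exactPrimalStep Φ f τ x y'‖ ≤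
      1 / (1 + τ * μx) * (τ * (‖w - gradX Φ x y‖ + Lxy * ‖y - y'‖)) := by
  have hμ := hprob.f_convex.modulus_nonneg
  rw [hx₁.eq_proxMap hprob.f_convex hτ, exactPrimalStep]
  refine (norm_proxMap_sub_le hprob.f_convex hτ _ _).trans ?_
  have e : x - τ • w - (x - τ • gradX Φ x y') =
      -(τ • ((w - gradX Φ x y) + (gradX Φ x y - gradX Φ x y'))) := by module
  rw [e, norm_neg, norm_smul, Real.norm_of_nonneg hτ.le]
  have h := hprob.lipschitz_x x hx x hx y hy y' hy'
  rw [sub_self, norm_zero, mul_zero, zero_add] at h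
  gcongr
  exact (norm_add_le _ _).trans (by gcongr)

/-- All inputs of the dual step are replaced at once: base point, current estimate and preceding
estimate. This propagates earlier replacements through one more update. -/
lemma norm_sub_exactDualStep_le' [FiniteDimensional ℝ Y]
    (hprob : ProblemAssumption f g Φ μx μy Lxx Lxy Lyx Lyy)
    (hσ : 0 < σ) (hθ : 0 ≤ θ) {x xh : X} {y yh y₁ v w w' : Y} (hx : x ∈ effDom f)
    (hxh : xh ∈ effDom f) (hy : y ∈ effDom g) (hyh : yh ∈ effDom g)
    (hy₁ : IsProx σ g (y + σ • (v + θ • (v - w))) y₁) :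
    ‖y₁ - exactDualStep Φ g σ θ w' xh yh‖ ≤ 1 / (1 + σ * μy) * (‖y - yh‖
      + σ * (1 + θ) * (Lyx * ‖x - xh‖ + Lyy * ‖y - yh‖)
      + σ * (1 + θ) * ‖v - gradY Φ x y‖ + σ * θ * ‖w - w'‖) := by
  have hμ := hprob.g_convex.modulus_nonneg
  rw [hy₁.eq_proxMap hprob.g_convex hσ, exactDualStep]
  refine (norm_proxMap_sub_le hprob.g_convex hσ _ _).trans ?_
  have e : y + σ • (v + θ • (v - w)) - (yh + σ • (gradY Φ xh yh + θ • (gradY Φ xh yh - w'))) =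
      (y - yh) + (σ * (1 + θ)) • (gradY Φ x y - gradY Φ xh yh)
        + (σ * (1 + θ)) • (v - gradY Φ x y) - (σ * θ) • (w - w') := by module
  rw [e]
  have h := hprob.lipschitz_y x hx xh hxh y hy yh hyh
  gcongr
  refine (norm_sub_le _ _).trans (add_le_add ((norm_add₃_le).trans ?_) ?_)
  · rw [norm_smul, norm_smul, Real.norm_of_nonneg (by positivity)]
    gcongr
  · rw [norm_smul, Real.norm_of_nonneg (by positivity)]

/-- The quadratic remainder left by replacing the iterates in the noise terms by exact steps. -/
noncomputable def noiseRemainder (μx μy Lxy Lyx Lyy τ σ θ d d' e e' : ℝ) : ℝ :=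
  τ * (1 / (1 + τ * μx)) * d ^ 2
    + θ * σ * (1 + θ) * Lyx * τ * (1 / (1 + τ * μx)) * (1 / (1 + σ * μy)) / 2 * d' ^ 2
    + ((1 + θ) ^ 2 + θ * (1 + θ) / 2) * σ * (1 / (1 + σ * μy)) * e ^ 2
    + σ * (1 / (1 + σ * μy)) * (θ * (1 + θ) * (1 / (1 + σ * μy))
      + θ * (1 + θ) * (Lyx * τ * (1 / (1 + τ * μx)) *
          (1 / 2 + Lxy * (1 / (1 + σ * μy)) * σ * (1 + θ))
        + Lyy * (1 / (1 + σ * μy)) * σ * (1 + θ))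
      + θ * (1 + θ) / 2 + θ ^ 2) * e' ^ 2

/-- The part of the noise that is linear in the current errors, with all other factors
independent of the current samples. -/
noncomputable def martingaleNoise (θ : ℝ) (D : X) (E E' : Y) (xs xh : X) (ys yb yh : Y) : ℝ :=
  -inner ℝ D (xh - xs) + (1 + θ) * inner ℝ E (yb - ys) - θ * inner ℝ E' (yh - ys)

/-- Each error is paired with a point free of its own sample. For `D` it suffices to make the primal
step exact, and for `E` the last dual step, which may keep the old estimate `gy'`. The old error
`E'` has entered `y₁` through `y`, `x` and the momentum, so its partner is rebuilt from `(x', y')`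
with exact gradients throughout, keeping only the older estimate `w`. -/
lemma noise_le [FiniteDimensional ℝ X] [FiniteDimensional ℝ Y]
    (hprob : ProblemAssumption f g Φ μx μy Lxx Lxy Lyx Lyy)
    (hτ : 0 < τ) (hσ : 0 < σ) (hθ : 0 ≤ θ) {x' x x₁ gx' gx : X} {y' y y₁ w gy' gy : Y}
    (hx' : x' ∈ effDom f)
    (hy : IsProx σ g (y' + σ • (gy' + θ • (gy' - w))) y)
    (hx : IsProx τ f (x' - τ • gx') x)
    (hy₁ : IsProx σ g (y + σ • (gy + θ • (gy - gy'))) y₁)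
    (hx₁ : IsProx τ f (x - τ • gx) x₁) :
    inner ℝ (gy + θ • (gy - gy') - (gradY Φ x y + θ • (gradY Φ x y - gradY Φ x' y'))) (y₁ - ys)
      - inner ℝ (gx - gradX Φ x y₁) (x₁ - xs) ≤
    martingaleNoise θ (gx - gradX Φ x y₁) (gy - gradY Φ x y) (gy' - gradY Φ x' y')
      xs (exactPrimalStep Φ f τ x y₁) ys (exactDualStep Φ g σ θ gy' x y)
      (exactDualStep Φ g σ θ (gradY Φ x' y')
        (exactPrimalStep Φ f τ x' (exactDualStep Φ g σ θ w x' y')) (exactDualStep Φ g σ θ w x' y'))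
    + noiseRemainder μx μy Lxy Lyx Lyy τ σ θ ‖gx - gradX Φ x y₁‖ ‖gx' - gradX Φ x' y‖
      ‖gy - gradY Φ x y‖ ‖gy' - gradY Φ x' y'‖ := by
  have hμx := hprob.f_convex.modulus_nonneg
  have hμy := hprob.g_convex.modulus_nonneg
  have hLyx := hprob.Lyx_pos.le
  have hLxy := hprob.Lxy_pos.le
  have hLyy := hprob.Lyy_nonneg
  have hmx := hx.mem_effDom hprob.f_convex hτ
  have hmy := hy.mem_effDom hprob.g_convex hσ
  have hmy₁ := hy₁.mem_effDom hprob.g_convex hσ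
  set yb' := exactDualStep Φ g σ θ w x' y'
  have hmb : yb' ∈ effDom g := proxMap_mem hprob.g_convex hσ _
  set xh := exactPrimalStep Φ f τ x' yb'
  have hmh : xh ∈ effDom f := proxMap_mem hprob.f_convex hτ _
  have b1 : ‖y - yb'‖ ≤ _ := norm_sub_exactDualStep_le hprob hσ hθ hy
  have b2 : ‖x - xh‖ ≤ _ := norm_sub_exactPrimalStep_le hprob hτ hx' hmy hmb hx
  have b3 := norm_sub_exactDualStep_le' (w' := gradY Φ x' y') hprob hσ hθ hmx hmh hmy hmb hy₁
  have b4 := norm_sub_exactDualStep_le (x := x) hprob hσ hθ hy₁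
  have b5 := norm_sub_exactPrimalStep_le hprob hτ hmx hmy₁ hmy₁ hx₁
  rw [sub_self, norm_zero, mul_zero, add_zero] at b5
  set E := gy - gradY Φ x y
  set E' := gy' - gradY Φ x' y'
  set D := gx - gradX Φ x y₁
  set D' := gx' - gradX Φ x' y
  have e0 : gy + θ • (gy - gy') - (gradY Φ x y + θ • (gradY Φ x y - gradY Φ x' y')) =
      (1 + θ) • E - θ • E' := by module
  rw [e0, inner_sub_left, real_inner_smul_left, real_inner_smul_left, martingaleNoise]
  have i1 := neg_inner_le_neg_inner_add_norm_mul D x₁ (exactPrimalStep Φ f τ x y₁) xs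
  have i2 := mul_le_mul_of_nonneg_left
    (inner_le_inner_add_norm_mul E y₁ (exactDualStep Φ g σ θ gy' x y) ys)
    (by positivity : 0 ≤ 1 + θ)
  have i3 := mul_le_mul_of_nonneg_left (neg_inner_le_neg_inner_add_norm_mul E' y₁
    (exactDualStep Φ g σ θ (gradY Φ x' y') xh yb') ys) hθ
  suffices h : ‖D‖ * ‖x₁ - exactPrimalStep Φ f τ x y₁‖
      + (1 + θ) * (‖E‖ * ‖y₁ - exactDualStep Φ g σ θ gy' x y‖)
      + θ * (‖E'‖ * ‖y₁ - exactDualStep Φ g σ θ (gradY Φ x' y') xh yb'‖) ≤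
      noiseRemainder μx μy Lxy Lyx Lyy τ σ θ ‖D‖ ‖D'‖ ‖E‖ ‖E'‖ by linarith
  clear i1 i2 i3 e0
  have hA : 0 ≤ 1 / (1 + σ * μy) := by positivity
  have hB : 0 ≤ 1 / (1 + τ * μx) := by positivity
  rw [noiseRemainder]
  set A := 1 / (1 + σ * μy)
  set B := 1 / (1 + τ * μx)
  -- Chains the three bounds: error of `y`, then of `x`, then of `y₁`.
  have c3 : ‖y₁ - exactDualStep Φ g σ θ (gradY Φ x' y') xh yb'‖ ≤
      A * (A * (σ * (1 + θ) * ‖E'‖)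
      + σ * (1 + θ) * (Lyx * (B * (τ * (‖D'‖ + Lxy * (A * (σ * (1 + θ) * ‖E'‖)))))
        + Lyy * (A * (σ * (1 + θ) * ‖E'‖)))
      + σ * (1 + θ) * ‖E‖ + σ * θ * ‖E'‖) := by
    refine b3.trans ?_
    have b2' := b2.trans (by gcongr : _ ≤ B * (τ * (‖D'‖ + Lxy * (A * (σ * (1 + θ) * ‖E'‖)))))
    gcongr
  have t1 := mul_le_mul_of_nonneg_left b5 (norm_nonneg D)
  have t2 := mul_le_mul_of_nonneg_left (mul_le_mul_of_nonneg_left b4 (norm_nonneg E))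
    (by positivity : 0 ≤ 1 + θ)
  have t3 := mul_le_mul_of_nonneg_left (mul_le_mul_of_nonneg_left c3 (norm_nonneg E')) hθ
  refine (add_le_add (add_le_add t1 t2) t3).trans ?_
  -- Only two products of different errors occur; splitting them evenly is the source of the halves
  -- in `xiX` and `xiY`.
  have s1 : ‖E'‖ * ‖D'‖ ≤ (‖E'‖ ^ 2 + ‖D'‖ ^ 2) / 2 := by
    linarith [two_mul_le_add_sq ‖E'‖ ‖D'‖]
  have s2 : ‖E'‖ * ‖E‖ ≤ (‖E'‖ ^ 2 + ‖E‖ ^ 2) / 2 := by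
    linarith [two_mul_le_add_sq ‖E'‖ ‖E‖]
  have m1 := mul_le_mul_of_nonneg_left s1
    (by positivity : 0 ≤ θ * A * σ * (1 + θ) * Lyx * B * τ)
  have m2 := mul_le_mul_of_nonneg_left s2 (by positivity : 0 ≤ θ * A * σ * (1 + θ))
  linarith

/-- The `δx ^ 2` coefficients agree up to the `ηx` term. All slack is in the `ηx` and `ηy` terms and
in `p3`, the excess of the factor `1 + 2 * θ` in `xiY` over what the decoupling needs. -/
lemma noiseRemainder_le_xi (hτ : 0 < τ) (hσ : 0 < σ) (hθ : 0 ≤ θ) (hμx : 0 ≤ μx) (hμy : 0 ≤ μy)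
    (hLxy : 0 ≤ Lxy) (hLyx : 0 ≤ Lyx) (hLyy : 0 ≤ Lyy) {ηx ηy : ℝ} (hηx : 0 < ηx) (hηy : 0 < ηy)
    (δx δy : ℝ) :
    noiseRemainder μx μy Lxy Lyx Lyy τ σ θ δx δx δy δy ≤
      xi μx μy Lxy Lyx Lyy τ σ θ ηx ηy δx δy := by
  have hA : 0 < 1 + σ * μy := by positivity
  have hB : 0 < 1 + τ * μx := by positivity
  rw [noiseRemainder, xi, xiX, xiY]
  have e1 : σ * θ * (1 + θ) * Lyx / (2 * (1 + σ * μy)) =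
      σ * θ * (1 + θ) * Lyx * (1 / (1 + σ * μy)) / 2 := by field_simp
  have e2 : (θ + σ * θ * (1 + θ) * Lyy) / (1 + σ * μy) =
      (θ + σ * θ * (1 + θ) * Lyy) * (1 / (1 + σ * μy)) := by field_simp
  have e3 : τ * σ * θ * (1 + θ) * Lyx * Lxy / ((1 + τ * μx) * (1 + σ * μy)) =
      τ * σ * θ * (1 + θ) * Lyx * Lxy * (1 / (1 + τ * μx)) * (1 / (1 + σ * μy)) := by field_simp
  have e4 : τ * θ * (1 + θ) * Lyx / (2 * (1 + τ * μx)) =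
      τ * θ * (1 + θ) * Lyx * (1 / (1 + τ * μx)) / 2 := by field_simp
  have e5 : τ / (1 + τ * μx) = τ * (1 / (1 + τ * μx)) := by field_simp
  have e6 : σ / (1 + σ * μy) = σ * (1 / (1 + σ * μy)) := by field_simp
  rw [e1, e2, e3, e4, e5, e6]
  have hA' : 0 ≤ 1 / (1 + σ * μy) := by positivity
  have hB' : 0 ≤ 1 / (1 + τ * μx) := by positivity
  generalize 1 / (1 + σ * μy) = A at *
  generalize 1 / (1 + τ * μx) = B at *
  have p1 : 0 ≤ 1 / (2 * ηx) * δx ^ 2 := by positivity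
  have p2 : 0 ≤ (1 + 2 * θ) / (2 * ηy) * δy ^ 2 := by positivity
  have p3 : 0 ≤ σ * A * (θ + θ ^ 2 + θ ^ 2 * A + σ * θ * (1 + θ) * Lyy * A * θ
      + τ * σ * θ * (1 + θ) * Lyx * Lxy * B * A * θ) * δy ^ 2 := by positivity
  linarith

end NoiseSplit

/-! ### Orthogonality of oracle errors to earlier quantities. -/

section Independence

variable {Ω : Type*} [MeasurableSpace Ω] {P : Measure Ω}

lemma integrable_inner_of_memLp {E : Type*} [NormedAddCommGroup E] [InnerProductSpace ℝ E]
    {U V : Ω → E} (hU : MemLp U 2 P) (hV : MemLp V 2 P) :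
    Integrable (fun ω => inner ℝ (U ω) (V ω)) P := by
  refine (hU.norm.integrable_mul hV.norm).mono' (hU.1.inner hV.1) (ae_of_all _ fun ω => ?_)
  exact norm_inner_le_norm _ _

/-- An unbiased oracle evaluated at a sample independent of `(p, V)` has an error orthogonal
to `V`. -/
lemma integral_inner_eq_zero_of_indepFun [IsProbabilityMeasure P] {A W E : Type*} [MeasurableSpace A] [MeasurableSpace W]
    [NormedAddCommGroup E] [InnerProductSpace ℝ E] [FiniteDimensional ℝ E] [MeasurableSpace E]
    [BorelSpace E] {p : Ω → A} {V : Ω → E} {w : Ω → W} {G : A × W → E} {h : Ω → E}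
    (hG : Measurable G) (hp : Measurable p) (hV : Measurable V) (hw : Measurable w)
    (hind : IndepFun (fun ω => (p ω, V ω)) w P)
    (hint : Integrable (fun ω => G (p ω, w ω)) P)
    (hce : P[fun ω => G (p ω, w ω) | MeasurableSpace.comap p inferInstance] =ᵐ[P] h)
    (hGh : MemLp (fun ω => G (p ω, w ω) - h ω) 2 P) (hV2 : MemLp V 2 P) :
    ∫ ω, inner ℝ (G (p ω, w ω) - h ω) (V ω) ∂P = 0 := by
  have : CompleteSpace E := FiniteDimensional.complete ℝ E
  have hprobw : IsProbabilityMeasure (P.map w) := Measure.isProbabilityMeasure_map hw.aemeasurable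
  -- Averaging over the sample alone gives a function of the query point. By independence `m ∘ p` is
  -- a version of the conditional expectation given `p`, hence equals `h` almost surely. This
  -- upgrades unbiasedness given the query point to unbiasedness given `(p, V)`.
  set m : A → E := fun a => ∫ b, G (a, b) ∂(P.map w) with hm
  have hmm : Measurable m := (hG.stronglyMeasurable.integral_prod_right').measurable
  have hind1 : IndepFun p w P := hind.comp (φ := Prod.fst) (ψ := id) measurable_fst measurable_id
  have hlaw1 := hind1.map_prod_eq_prod_map_map hp.aemeasurable hw.aemeasurable
  have hint1 : Integrable G ((P.map p).prod (P.map w)) := by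
    rw [← hlaw1, integrable_map_measure hG.aestronglyMeasurable (by fun_prop)]
    exact hint
  have hmp : (fun ω => m (p ω)) =ᵐ[P] h := by
    refine (ae_eq_condExp_of_forall_setIntegral_eq hp.comap_le hint ?_ ?_ ?_).trans hce
    · intro s _ _
      refine Integrable.integrableOn ?_
      exact (integrable_map_measure hmm.aestronglyMeasurable hp.aemeasurable).1
        hint1.integral_prod_left
    · rintro s ⟨B, hB, rfl⟩ -
      have h1 : ∫ ω in p ⁻¹' B, m (p ω) ∂P = ∫ a in B, m a ∂(P.map p) :=
        (setIntegral_map hB hmm.aestronglyMeasurable hp.aemeasurable).symm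
      have h2 := setIntegral_prod (s := B) (t := Set.univ) G hint1.integrableOn
      rw [Measure.restrict_univ] at h2
      have h3 : p ⁻¹' B = (fun ω => (p ω, w ω)) ⁻¹' (B ×ˢ Set.univ) := by ext; simp
      rw [h1, ← h2, ← hlaw1, setIntegral_map (hB.prod MeasurableSet.univ)
        hG.aestronglyMeasurable (by fun_prop), ← h3]
    · exact (hmm.stronglyMeasurable.comp_measurable
        (comap_measurable p)).aestronglyMeasurable
  have hlaw := hind.map_prod_eq_prod_map_map (by fun_prop) hw.aemeasurable
  set F : (A × E) × W → ℝ := fun z => inner ℝ (G (z.1.1, z.2) - m z.1.1) z.1.2 with hF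
  have hFm : Measurable F := by
    refine Measurable.inner ?_ (by fun_prop)
    exact (hG.comp (by fun_prop)).sub (hmm.comp (by fun_prop))
  have hmap : Measurable (fun ω => ((p ω, V ω), w ω)) := by fun_prop
  have hae : (fun ω => inner ℝ (G (p ω, w ω) - h ω) (V ω)) =ᵐ[P]
      fun ω => F ((p ω, V ω), w ω) := by
    filter_upwards [hmp] with ω hω
    simp only [hF, hω]
  have hFint : Integrable F ((P.map fun ω => (p ω, V ω)).prod (P.map w)) := by
    rw [← hlaw, integrable_map_measure hFm.aestronglyMeasurable hmap.aemeasurable]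
    exact (integrable_inner_of_memLp hGh hV2).congr hae
  have hGint : Integrable (fun z : (A × E) × W => G (z.1.1, z.2))
      ((P.map fun ω => (p ω, V ω)).prod (P.map w)) := by
    have hGm : Measurable (fun z : (A × E) × W => G (z.1.1, z.2)) := hG.comp (by fun_prop)
    rw [← hlaw, integrable_map_measure hGm.aestronglyMeasurable hmap.aemeasurable]
    exact hint
  -- Fubini under the product law: for fixed `(p, V)` the inner integral over the sample vanishes by
  -- the definition of `m`.
  rw [integral_congr_ae hae, ← integral_map (φ := fun ω => ((p ω, V ω), w ω)) (f := F)
    hmap.aemeasurable hFm.aestronglyMeasurable, hlaw, integral_prod F hFint]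
  refine integral_eq_zero_of_ae ?_
  filter_upwards [hGint.prod_right_ae] with z hz
  have h4 : Integrable (fun b => G (z.1, b) - m z.1) (P.map w) := hz.sub (integrable_const _)
  have h5 : ∫ b, inner ℝ (G (z.1, b) - m z.1) z.2 ∂(P.map w) =
      inner ℝ (∫ b, (G (z.1, b) - m z.1) ∂(P.map w)) z.2 := by
    simp_rw [real_inner_comm z.2]
    exact integral_inner h4 z.2
  simp only [hF, Pi.zero_apply]
  rw [h5, integral_sub hz (integrable_const _)]
  simp [hm]

end Independence

/-! ### The filtration generated by the samples. -/

section History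

variable {Ω : Type*}
  {Wx Wy : Type*} [MeasurableSpace Wx] [MeasurableSpace Wy]
  {ωx : ℕ → Ω → Wx} {ωy : ℕ → Ω → Wy}

/-- The σ-algebras generated by the individual samples. -/
@[reducible] def sampleAlgebra (ωx : ℕ → Ω → Wx) (ωy : ℕ → Ω → Wy) : ℕ ⊕ ℕ → MeasurableSpace Ω :=
  Sum.elim (fun i => MeasurableSpace.comap (ωx i) inferInstance)
    (fun j => MeasurableSpace.comap (ωy j) inferInstance)

/-- The information in the samples `ωx i`, `i < a`, and `ωy j`, `j < b`. -/
@[reducible] def history (ωx : ℕ → Ω → Wx) (ωy : ℕ → Ω → Wy) (a b : ℕ) : MeasurableSpace Ω :=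
  ⨆ i ∈ {i : ℕ ⊕ ℕ | Sum.elim (· < a) (· < b) i}, sampleAlgebra ωx ωy i

lemma history_mono {a b a' b' : ℕ} (ha : a ≤ a') (hb : b ≤ b') :
    history ωx ωy a b ≤ history ωx ωy a' b' := by
  refine biSup_mono ?_
  rintro (i | j) h
  · exact lt_of_lt_of_le (show i < a from h) ha
  · exact lt_of_lt_of_le (show j < b from h) hb

lemma measurable_history_x {a b i : ℕ} (h : i < a) : Measurable[history ωx ωy a b] (ωx i) := by
  refine measurable_iff_comap_le.2 ?_
  exact le_iSup₂ (f := fun i (_ : i ∈ {i : ℕ ⊕ ℕ | Sum.elim (· < a) (· < b) i}) =>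
    sampleAlgebra ωx ωy i) (Sum.inl i) h

lemma measurable_history_y {a b j : ℕ} (h : j < b) : Measurable[history ωx ωy a b] (ωy j) := by
  refine measurable_iff_comap_le.2 ?_
  exact le_iSup₂ (f := fun i (_ : i ∈ {i : ℕ ⊕ ℕ | Sum.elim (· < a) (· < b) i}) =>
    sampleAlgebra ωx ωy i) (Sum.inr j) h

variable [MeasurableSpace Ω] {P : Measure Ω}

/-- A finite intersection over the sum type splits into an event of the first sequence and one of
the second. Independence of the sequences factors these, and independence within each sequence does
the rest. -/
lemma iIndep_sampleAlgebra (hx : iIndepFun ωx P) (hy : iIndepFun ωy P)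
    (hxy : IndepFun (fun ω k => ωx k ω) (fun ω k => ωy k ω) P) :
    iIndep (sampleAlgebra ωx ωy) P := by
  rw [iIndep_iff]
  intro s F hF
  have h1 := (iIndep_iff _ _).1 hx s.toLeft (f := fun i => F (Sum.inl i))
    fun i hi => hF (Sum.inl i) (by simpa using hi)
  have h2 := (iIndep_iff _ _).1 hy s.toRight (f := fun i => F (Sum.inr i))
    fun i hi => hF (Sum.inr i) (by simpa using hi)
  have hs : ⋂ i ∈ s, F i = (⋂ i ∈ s.toLeft, F (Sum.inl i)) ∩ ⋂ i ∈ s.toRight, F (Sum.inr i) := by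
    ext ω
    simp only [Set.mem_iInter, Set.mem_inter_iff, Finset.mem_toLeft, Finset.mem_toRight]
    exact Sum.forall
  have hp : ∏ i ∈ s, P (F i) =
      (∏ i ∈ s.toLeft, P (F (Sum.inl i))) * ∏ i ∈ s.toRight, P (F (Sum.inr i)) := by
    conv_lhs => rw [← s.toLeft_disjSum_toRight]
    exact Finset.prod_disjSum _ _ _
  rw [hs, hp, ← h1, ← h2]
  refine (IndepFun_iff _ _ _).1 hxy _ _ ?_ ?_
  · refine Finset.measurableSet_biInter _ fun i hi => ?_
    obtain ⟨B, hB, hBe⟩ := hF (Sum.inl i) (by simpa using hi)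
    exact ⟨(fun z => z i) ⁻¹' B, measurable_pi_apply i hB, hBe⟩
  · refine Finset.measurableSet_biInter _ fun i hi => ?_
    obtain ⟨B, hB, hBe⟩ := hF (Sum.inr i) (by simpa using hi)
    exact ⟨(fun z => z i) ⁻¹' B, measurable_pi_apply i hB, hBe⟩

lemma sampleAlgebra_le (hx : ∀ k, Measurable (ωx k)) (hy : ∀ k, Measurable (ωy k)) (i : ℕ ⊕ ℕ) :
    sampleAlgebra ωx ωy i ≤ ‹MeasurableSpace Ω› := by
  rcases i with i | j
  · exact (hx i).comap_le
  · exact (hy j).comap_le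

lemma history_le (hx : ∀ k, Measurable (ωx k)) (hy : ∀ k, Measurable (ωy k)) (a b : ℕ) :
    history ωx ωy a b ≤ ‹MeasurableSpace Ω› :=
  iSup₂_le fun i _ => sampleAlgebra_le hx hy i

lemma indep_history (hmx : ∀ k, Measurable (ωx k)) (hmy : ∀ k, Measurable (ωy k))
    (hx : iIndepFun ωx P) (hy : iIndepFun ωy P)
    (hxy : IndepFun (fun ω k => ωx k ω) (fun ω k => ωy k ω) P) {a b : ℕ} {i : ℕ ⊕ ℕ}
    (hi : ¬ Sum.elim (· < a) (· < b) i) :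
    Indep (history ωx ωy a b) (sampleAlgebra ωx ωy i) P := by
  have := indep_iSup_of_disjoint (sampleAlgebra_le hmx hmy) (iIndep_sampleAlgebra hx hy hxy)
    (S := {i : ℕ ⊕ ℕ | Sum.elim (· < a) (· < b) i}) (T := {i})
    (Set.disjoint_singleton_right.2 hi)
  simpa [history] using this

lemma indepFun_history_x (hmx : ∀ k, Measurable (ωx k)) (hmy : ∀ k, Measurable (ωy k))
    (hx : iIndepFun ωx P) (hy : iIndepFun ωy P)
    (hxy : IndepFun (fun ω k => ωx k ω) (fun ω k => ωy k ω) P) {A : Type*} [MeasurableSpace A]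
    {a b : ℕ} {Z : Ω → A} (hZ : Measurable[history ωx ωy a b] Z) : IndepFun Z (ωx a) P :=
  indep_of_indep_of_le_left (indep_history hmx hmy hx hy hxy (i := Sum.inl a) (by simp))
    hZ.comap_le

lemma indepFun_history_y (hmx : ∀ k, Measurable (ωx k)) (hmy : ∀ k, Measurable (ωy k))
    (hx : iIndepFun ωx P) (hy : iIndepFun ωy P)
    (hxy : IndepFun (fun ω k => ωx k ω) (fun ω k => ωy k ω) P) {A : Type*} [MeasurableSpace A]
    {a b : ℕ} {Z : Ω → A} (hZ : Measurable[history ωx ωy a b] Z) : IndepFun Z (ωy b) P :=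
  indep_of_indep_of_le_left (indep_history hmx hmy hx hy hxy (i := Sum.inr b) (by simp))
    hZ.comap_le

end History

set_option linter.unusedSectionVars false

/-! ### Measurability and square integrability of gradients and exact steps. -/

section Measurability

lemma measurable_oracle_comp {A B C D Ω : Type*} [MeasurableSpace A] [MeasurableSpace B]
    [MeasurableSpace C] [MeasurableSpace D] {m : MeasurableSpace Ω} {G : A → B → C → D}
    (hG : Measurable (fun p : A × B × C => G p.1 p.2.1 p.2.2)) {u : Ω → A} {v : Ω → B} {w : Ω → C}
    (hu : Measurable u) (hv : Measurable v) (hw : Measurable w) :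
    Measurable (fun ω => G (u ω) (v ω) (w ω)) :=
  hG.comp (hu.prodMk (hv.prodMk hw))

variable {X Y Ω Wx Wy : Type*}
  [NormedAddCommGroup X] [InnerProductSpace ℝ X] [FiniteDimensional ℝ X] [CompleteSpace X]
  [MeasurableSpace X] [BorelSpace X]
  [NormedAddCommGroup Y] [InnerProductSpace ℝ Y] [FiniteDimensional ℝ Y] [CompleteSpace Y]
  [MeasurableSpace Y] [BorelSpace Y]
  {f : X → EReal} {g : Y → EReal} {Φ : X → Y → ℝ} {μx μy Lxx Lxy Lyx Lyy : ℝ}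
  {τ σ θ : ℝ} {m : MeasurableSpace Ω} {u : Ω → X} {v w : Ω → Y}

/-- The Lipschitz bound gives continuity only on the product of the effective domains, so the
composition goes through that subtype. The σ-algebra on `Ω` is arbitrary, to allow histories. -/
lemma measurable_gradX_comp (hprob : ProblemAssumption f g Φ μx μy Lxx Lxy Lyx Lyy)
    (hu : Measurable u) (hv : Measurable v) (hud : ∀ ω, u ω ∈ effDom f)
    (hvd : ∀ ω, v ω ∈ effDom g) : Measurable (fun ω => gradX Φ (u ω) (v ω)) := by
  have hcont : Continuous
      (fun z : {z : X × Y // z.1 ∈ effDom f ∧ z.2 ∈ effDom g} => gradX Φ z.1.1 z.1.2) := by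
    refine continuous_iff_continuousAt.2 fun z => tendsto_iff_norm_sub_tendsto_zero.2 ?_
    have h0 : Tendsto (fun z' : {z : X × Y // z.1 ∈ effDom f ∧ z.2 ∈ effDom g} =>
        Lxx * ‖z'.1.1 - z.1.1‖ + Lxy * ‖z'.1.2 - z.1.2‖) (nhds z) (nhds 0) := by
      have : Continuous (fun z' : {z : X × Y // z.1 ∈ effDom f ∧ z.2 ∈ effDom g} =>
        Lxx * ‖z'.1.1 - z.1.1‖ + Lxy * ‖z'.1.2 - z.1.2‖) := by fun_prop
      simpa using this.tendsto z
    exact squeeze_zero (fun _ => norm_nonneg _)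
      (fun z' => hprob.lipschitz_x _ z'.2.1 _ z.2.1 _ z'.2.2 _ z.2.2) h0
  exact hcont.measurable.comp
    ((hu.prodMk hv).subtype_mk (h := fun ω => ⟨hud ω, hvd ω⟩))

lemma measurable_gradY_comp (hprob : ProblemAssumption f g Φ μx μy Lxx Lxy Lyx Lyy)
    (hu : Measurable u) (hv : Measurable v) (hud : ∀ ω, u ω ∈ effDom f)
    (hvd : ∀ ω, v ω ∈ effDom g) : Measurable (fun ω => gradY Φ (u ω) (v ω)) := by
  have hcont : Continuous
      (fun z : {z : X × Y // z.1 ∈ effDom f ∧ z.2 ∈ effDom g} => gradY Φ z.1.1 z.1.2) := by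
    refine continuous_iff_continuousAt.2 fun z => tendsto_iff_norm_sub_tendsto_zero.2 ?_
    have h0 : Tendsto (fun z' : {z : X × Y // z.1 ∈ effDom f ∧ z.2 ∈ effDom g} =>
        Lyx * ‖z'.1.1 - z.1.1‖ + Lyy * ‖z'.1.2 - z.1.2‖) (nhds z) (nhds 0) := by
      have : Continuous (fun z' : {z : X × Y // z.1 ∈ effDom f ∧ z.2 ∈ effDom g} =>
        Lyx * ‖z'.1.1 - z.1.1‖ + Lyy * ‖z'.1.2 - z.1.2‖) := by fun_prop
      simpa using this.tendsto z
    exact squeeze_zero (fun _ => norm_nonneg _)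
      (fun z' => hprob.lipschitz_y _ z'.2.1 _ z.2.1 _ z'.2.2 _ z.2.2) h0
  exact hcont.measurable.comp
    ((hu.prodMk hv).subtype_mk (h := fun ω => ⟨hud ω, hvd ω⟩))

lemma measurable_exactDualStep (hprob : ProblemAssumption f g Φ μx μy Lxx Lxy Lyx Lyy)
    (hσ : 0 < σ) (hw : Measurable w) (hu : Measurable u) (hv : Measurable v)
    (hud : ∀ ω, u ω ∈ effDom f) (hvd : ∀ ω, v ω ∈ effDom g) :
    Measurable (fun ω => exactDualStep Φ g σ θ (w ω) (u ω) (v ω)) := by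
  have h := measurable_gradY_comp hprob hu hv hud hvd
  exact (continuous_proxMap hprob.g_convex hσ).measurable.comp
    (hv.add ((h.add ((h.sub hw).const_smul θ)).const_smul σ))

lemma measurable_exactPrimalStep (hprob : ProblemAssumption f g Φ μx μy Lxx Lxy Lyx Lyy)
    (hτ : 0 < τ) (hu : Measurable u) (hv : Measurable v)
    (hud : ∀ ω, u ω ∈ effDom f) (hvd : ∀ ω, v ω ∈ effDom g) :
    Measurable (fun ω => exactPrimalStep Φ f τ (u ω) (v ω)) :=
  (continuous_proxMap hprob.f_convex hτ).measurable.comp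
    (hu.sub ((measurable_gradX_comp hprob hu hv hud hvd).const_smul τ))

variable {P : Measure Ω} [IsProbabilityMeasure P]

lemma memLp_proxMap_comp {E : Type*} [NormedAddCommGroup E] [InnerProductSpace ℝ E]
    [FiniteDimensional ℝ E] {h : E → EReal} {μ c : ℝ} (hh : IsProperClosedConvex h μ)
    (hc : 0 < c) {z : Ω → E} (hz : MemLp z 2 P) : MemLp (fun ω => proxMap c h (z ω)) 2 P := by
  refine ((memLp_const ‖proxMap c h 0‖).add hz.norm).mono'
    ((continuous_proxMap hh hc).comp_aestronglyMeasurable hz.1) (ae_of_all _ fun ω => ?_)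
  have h1 := norm_proxMap_sub_le' hh hc (z ω) 0
  rw [sub_zero] at h1
  have h2 := norm_le_norm_add_norm_sub' (proxMap c h (z ω)) (proxMap c h 0)
  simp only [Pi.add_apply]
  linarith

lemma memLp_gradX_comp (hprob : ProblemAssumption f g Φ μx μy Lxx Lxy Lyx Lyy)
    (hum : Measurable u) (hvm : Measurable v)
    (hu : MemLp u 2 P) (hv : MemLp v 2 P) (hud : ∀ ω, u ω ∈ effDom f)
    (hvd : ∀ ω, v ω ∈ effDom g) : MemLp (fun ω => gradX Φ (u ω) (v ω)) 2 P := by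
  obtain ⟨a, ha⟩ := hprob.f_convex.nonempty
  obtain ⟨b, hb⟩ := hprob.g_convex.nonempty
  refine (((memLp_const ‖gradX Φ a b‖).add ((hu.sub (memLp_const a)).norm.const_mul Lxx)).add
    ((hv.sub (memLp_const b)).norm.const_mul Lxy)).mono'
    (measurable_gradX_comp hprob hum hvm hud hvd).aestronglyMeasurable (ae_of_all _ fun ω => ?_)
  have h1 := hprob.lipschitz_x _ (hud ω) a ha _ (hvd ω) b hb
  have h2 := norm_le_norm_add_norm_sub' (gradX Φ (u ω) (v ω)) (gradX Φ a b)
  simp only [Pi.add_apply, Pi.sub_apply]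
  linarith

lemma memLp_gradY_comp (hprob : ProblemAssumption f g Φ μx μy Lxx Lxy Lyx Lyy)
    (hum : Measurable u) (hvm : Measurable v)
    (hu : MemLp u 2 P) (hv : MemLp v 2 P) (hud : ∀ ω, u ω ∈ effDom f)
    (hvd : ∀ ω, v ω ∈ effDom g) : MemLp (fun ω => gradY Φ (u ω) (v ω)) 2 P := by
  obtain ⟨a, ha⟩ := hprob.f_convex.nonempty
  obtain ⟨b, hb⟩ := hprob.g_convex.nonempty
  refine (((memLp_const ‖gradY Φ a b‖).add ((hu.sub (memLp_const a)).norm.const_mul Lyx)).add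
    ((hv.sub (memLp_const b)).norm.const_mul Lyy)).mono'
    (measurable_gradY_comp hprob hum hvm hud hvd).aestronglyMeasurable (ae_of_all _ fun ω => ?_)
  have h1 := hprob.lipschitz_y _ (hud ω) a ha _ (hvd ω) b hb
  have h2 := norm_le_norm_add_norm_sub' (gradY Φ (u ω) (v ω)) (gradY Φ a b)
  simp only [Pi.add_apply, Pi.sub_apply]
  linarith

lemma memLp_exactDualStep (hprob : ProblemAssumption f g Φ μx μy Lxx Lxy Lyx Lyy)
    (hσ : 0 < σ) (hum : Measurable u) (hvm : Measurable v)
    (hw : MemLp w 2 P) (hu : MemLp u 2 P) (hv : MemLp v 2 P)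
    (hud : ∀ ω, u ω ∈ effDom f) (hvd : ∀ ω, v ω ∈ effDom g) :
    MemLp (fun ω => exactDualStep Φ g σ θ (w ω) (u ω) (v ω)) 2 P := by
  have h := memLp_gradY_comp hprob hum hvm hu hv hud hvd
  exact memLp_proxMap_comp hprob.g_convex hσ
    (hv.add ((h.add ((h.sub hw).const_smul θ)).const_smul σ))

lemma memLp_exactPrimalStep (hprob : ProblemAssumption f g Φ μx μy Lxx Lxy Lyx Lyy)
    (hτ : 0 < τ) (hum : Measurable u) (hvm : Measurable v)
    (hu : MemLp u 2 P) (hv : MemLp v 2 P)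
    (hud : ∀ ω, u ω ∈ effDom f) (hvd : ∀ ω, v ω ∈ effDom g) :
    MemLp (fun ω => exactPrimalStep Φ f τ (u ω) (v ω)) 2 P :=
  memLp_proxMap_comp hprob.f_convex hτ
    (hu.sub ((memLp_gradX_comp hprob hum hvm hu hv hud hvd).const_smul τ))

end Measurability

/-! ### The iterates are adapted and square integrable. -/

section Iterates

variable {X Y Ω Wx Wy : Type*}
  [NormedAddCommGroup X] [InnerProductSpace ℝ X] [FiniteDimensional ℝ X] [CompleteSpace X]
  [MeasurableSpace X] [BorelSpace X]
  [NormedAddCommGroup Y] [InnerProductSpace ℝ Y] [FiniteDimensional ℝ Y] [CompleteSpace Y]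
  [MeasurableSpace Y] [BorelSpace Y]
  [MeasurableSpace Ω] [MeasurableSpace Wx] [MeasurableSpace Wy]
  {P : Measure Ω} [IsProbabilityMeasure P]
  {f : X → EReal} {g : Y → EReal} {Φ : X → Y → ℝ} {μx μy Lxx Lxy Lyx Lyy : ℝ}
  {Gx : X → Y → Wx → X} {Gy : X → Y → Wy → Y} {ωx : ℕ → Ω → Wx} {ωy : ℕ → Ω → Wy}
  {τ σ θ : ℝ} {x₀ : X} {y₀ : Y} {x : ℕ → Ω → X} {y : ℕ → Ω → Y} {δx δy : ℝ}

lemma IsGenerated.x_mem (hgen : IsGenerated f g Gx Gy ωx ωy τ σ θ x₀ y₀ x y)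
    (hprob : ProblemAssumption f g Φ μx μy Lxx Lxy Lyx Lyy) (hτ : 0 < τ)
    (hx₀ : x₀ ∈ effDom f) (k : ℕ) (ω : Ω) : x k ω ∈ effDom f := by
  cases k with
  | zero => rwa [hgen.x_zero]
  | succ k => exact (hgen.x_step k ω).mem_effDom hprob.f_convex hτ

lemma IsGenerated.y_mem (hgen : IsGenerated f g Gx Gy ωx ωy τ σ θ x₀ y₀ x y)
    (hprob : ProblemAssumption f g Φ μx μy Lxx Lxy Lyx Lyy) (hσ : 0 < σ)
    (hy₀ : y₀ ∈ effDom g) (k : ℕ) (ω : Ω) : y k ω ∈ effDom g := by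
  cases k with
  | zero => rwa [hgen.y_zero]
  | succ k => exact (hgen.y_step k ω).mem_effDom hprob.g_convex hσ

lemma IsGenerated.y_succ_eq (hgen : IsGenerated f g Gx Gy ωx ωy τ σ θ x₀ y₀ x y)
    (hprob : ProblemAssumption f g Φ μx μy Lxx Lxy Lyx Lyy) (hσ : 0 < σ) (k : ℕ) :
    y (k + 1) = fun ω => proxMap σ g
      (y k ω + σ • (Gy (x k ω) (y k ω) (ωy (k + 1) ω) +
        θ • (Gy (x k ω) (y k ω) (ωy (k + 1) ω) - Gy (x (k - 1) ω) (y (k - 1) ω) (ωy k ω)))) :=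
  funext fun ω => (hgen.y_step k ω).eq_proxMap hprob.g_convex hσ

lemma IsGenerated.x_succ_eq (hgen : IsGenerated f g Gx Gy ωx ωy τ σ θ x₀ y₀ x y)
    (hprob : ProblemAssumption f g Φ μx μy Lxx Lxy Lyx Lyy) (hτ : 0 < τ) (k : ℕ) :
    x (k + 1) = fun ω => proxMap τ f (x k ω - τ • Gx (x k ω) (y (k + 1) ω) (ωx k ω)) :=
  funext fun ω => (hgen.x_step k ω).eq_proxMap hprob.f_convex hτ

/-- The half step matters: `y (k + 1)` uses the sample `ωy (k + 1)` but not yet `ωx k`, so the query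
point of the primal oracle is independent of `ωx k`. -/
lemma measurable_iterates_aux (hgen : IsGenerated f g Gx Gy ωx ωy τ σ θ x₀ y₀ x y)
    (hprob : ProblemAssumption f g Φ μx μy Lxx Lxy Lyx Lyy) (hτ : 0 < τ) (hσ : 0 < σ)
    (hnoise : NoiseAssumption P Φ Gx Gy ωx ωy δx δy x y) {k : ℕ}
    (ih : ∀ j ≤ k, Measurable[history ωx ωy k (k + 1)] (x j) ∧
      Measurable[history ωx ωy k (k + 1)] (y j)) :
    Measurable[history ωx ωy k (k + 2)] (y (k + 1)) ∧
      Measurable[history ωx ωy (k + 1) (k + 2)] (x (k + 1)) := by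
  have hle : history ωx ωy k (k + 1) ≤ history ωx ωy k (k + 2) := history_mono le_rfl (by simp)
  have hle' : history ωx ωy k (k + 2) ≤ history ωx ωy (k + 1) (k + 2) :=
    history_mono (by simp) le_rfl
  have hxk := (ih k le_rfl).1.mono hle le_rfl
  have hyk := (ih k le_rfl).2.mono hle le_rfl
  have hxk' := (ih (k - 1) (Nat.sub_le k 1)).1.mono hle le_rfl
  have hyk' := (ih (k - 1) (Nat.sub_le k 1)).2.mono hle le_rfl
  have hy : Measurable[history ωx ωy k (k + 2)] (y (k + 1)) := by
    have h1 := measurable_oracle_comp hnoise.measurable_Gy hxk hyk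
      (measurable_history_y (ωx := ωx) (ωy := ωy) (a := k) (by simp : k + 1 < k + 2))
    have h2 := measurable_oracle_comp hnoise.measurable_Gy hxk' hyk'
      (measurable_history_y (ωx := ωx) (ωy := ωy) (a := k) (by simp : k < k + 2))
    rw [hgen.y_succ_eq hprob hσ k]
    exact (continuous_proxMap hprob.g_convex hσ).measurable.comp
      (hyk.add ((h1.add ((h1.sub h2).const_smul θ)).const_smul σ))
  refine ⟨hy, ?_⟩
  have h3 := measurable_oracle_comp hnoise.measurable_Gx (hxk.mono hle' le_rfl) (hy.mono hle' le_rfl)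
    (measurable_history_x (ωx := ωx) (ωy := ωy) (b := k + 2) (by simp : k < k + 1))
  rw [hgen.x_succ_eq hprob hτ k]
  exact (continuous_proxMap hprob.f_convex hτ).measurable.comp
    ((hxk.mono hle' le_rfl).sub (h3.const_smul τ))

lemma measurable_iterates (hgen : IsGenerated f g Gx Gy ωx ωy τ σ θ x₀ y₀ x y)
    (hprob : ProblemAssumption f g Φ μx μy Lxx Lxy Lyx Lyy) (hτ : 0 < τ) (hσ : 0 < σ)
    (hnoise : NoiseAssumption P Φ Gx Gy ωx ωy δx δy x y) (k : ℕ) :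
    ∀ j ≤ k, Measurable[history ωx ωy k (k + 1)] (x j) ∧
      Measurable[history ωx ωy k (k + 1)] (y j) := by
  induction k with
  | zero =>
    intro j hj
    obtain rfl : j = 0 := by omega
    rw [show x 0 = fun _ => x₀ from funext hgen.x_zero,
      show y 0 = fun _ => y₀ from funext hgen.y_zero]
    exact ⟨measurable_const, measurable_const⟩
  | succ k ih =>
    intro j hj
    rcases Nat.le_succ_iff.1 hj with hj | rfl
    · have hle : history ωx ωy k (k + 1) ≤ history ωx ωy (k + 1) (k + 1 + 1) :=
        history_mono (by simp) (by simp)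
      exact ⟨(ih j hj).1.mono hle le_rfl, (ih j hj).2.mono hle le_rfl⟩
    · have h := measurable_iterates_aux hgen hprob hτ hσ hnoise ih
      exact ⟨h.2, h.1.mono (history_mono (by simp) le_rfl) le_rfl⟩

lemma measurable_iterates_y_succ (hgen : IsGenerated f g Gx Gy ωx ωy τ σ θ x₀ y₀ x y)
    (hprob : ProblemAssumption f g Φ μx μy Lxx Lxy Lyx Lyy) (hτ : 0 < τ) (hσ : 0 < σ)
    (hnoise : NoiseAssumption P Φ Gx Gy ωx ωy δx δy x y) (k : ℕ) :
    Measurable[history ωx ωy k (k + 2)] (y (k + 1)) :=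
  (measurable_iterates_aux hgen hprob hτ hσ hnoise
    (measurable_iterates hgen hprob hτ hσ hnoise k)).1

lemma measurable_x (hgen : IsGenerated f g Gx Gy ωx ωy τ σ θ x₀ y₀ x y)
    (hprob : ProblemAssumption f g Φ μx μy Lxx Lxy Lyx Lyy) (hτ : 0 < τ) (hσ : 0 < σ)
    (hnoise : NoiseAssumption P Φ Gx Gy ωx ωy δx δy x y) (k : ℕ) : Measurable (x k) :=
  (measurable_iterates hgen hprob hτ hσ hnoise k k le_rfl).1.mono
    (history_le hnoise.measurable_ωx hnoise.measurable_ωy _ _) le_rfl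

lemma measurable_y (hgen : IsGenerated f g Gx Gy ωx ωy τ σ θ x₀ y₀ x y)
    (hprob : ProblemAssumption f g Φ μx μy Lxx Lxy Lyx Lyy) (hτ : 0 < τ) (hσ : 0 < σ)
    (hnoise : NoiseAssumption P Φ Gx Gy ωx ωy δx δy x y) (k : ℕ) : Measurable (y k) :=
  (measurable_iterates hgen hprob hτ hσ hnoise k k le_rfl).2.mono
    (history_le hnoise.measurable_ωx hnoise.measurable_ωy _ _) le_rfl

lemma memLp_noise_x (hgen : IsGenerated f g Gx Gy ωx ωy τ σ θ x₀ y₀ x y)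
    (hprob : ProblemAssumption f g Φ μx μy Lxx Lxy Lyx Lyy) (hτ : 0 < τ) (hσ : 0 < σ)
    (hx₀ : x₀ ∈ effDom f) (hy₀ : y₀ ∈ effDom g)
    (hnoise : NoiseAssumption P Φ Gx Gy ωx ωy δx δy x y) (k : ℕ) :
    MemLp (fun ω => Gx (x k ω) (y (k + 1) ω) (ωx k ω) - gradX Φ (x k ω) (y (k + 1) ω)) 2 P := by
  have hx := measurable_x hgen hprob hτ hσ hnoise k
  have hy := measurable_y hgen hprob hτ hσ hnoise (k + 1)
  refine (memLp_two_iff_integrable_sq_norm ?_).2 (hnoise.sq_integrable_x k)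
  exact ((measurable_oracle_comp hnoise.measurable_Gx hx hy (hnoise.measurable_ωx k)).sub
    (measurable_gradX_comp hprob hx hy (hgen.x_mem hprob hτ hx₀ _)
      (hgen.y_mem hprob hσ hy₀ _))).aestronglyMeasurable

lemma memLp_noise_y (hgen : IsGenerated f g Gx Gy ωx ωy τ σ θ x₀ y₀ x y)
    (hprob : ProblemAssumption f g Φ μx μy Lxx Lxy Lyx Lyy) (hτ : 0 < τ) (hσ : 0 < σ)
    (hx₀ : x₀ ∈ effDom f) (hy₀ : y₀ ∈ effDom g)
    (hnoise : NoiseAssumption P Φ Gx Gy ωx ωy δx δy x y) (j : ℕ) :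
    MemLp (fun ω => Gy (x (j - 1) ω) (y (j - 1) ω) (ωy j ω)
      - gradY Φ (x (j - 1) ω) (y (j - 1) ω)) 2 P := by
  have hx := measurable_x hgen hprob hτ hσ hnoise (j - 1)
  have hy := measurable_y hgen hprob hτ hσ hnoise (j - 1)
  refine (memLp_two_iff_integrable_sq_norm ?_).2 (hnoise.sq_integrable_y j)
  exact ((measurable_oracle_comp hnoise.measurable_Gy hx hy (hnoise.measurable_ωy j)).sub
    (measurable_gradY_comp hprob hx hy (hgen.x_mem hprob hτ hx₀ _)
      (hgen.y_mem hprob hσ hy₀ _))).aestronglyMeasurable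

lemma memLp_Gx_of_memLp (hgen : IsGenerated f g Gx Gy ωx ωy τ σ θ x₀ y₀ x y)
    (hprob : ProblemAssumption f g Φ μx μy Lxx Lxy Lyx Lyy) (hτ : 0 < τ) (hσ : 0 < σ)
    (hx₀ : x₀ ∈ effDom f) (hy₀ : y₀ ∈ effDom g)
    (hnoise : NoiseAssumption P Φ Gx Gy ωx ωy δx δy x y) (k : ℕ)
    (hxL : MemLp (x k) 2 P) (hyL : MemLp (y (k + 1)) 2 P) :
    MemLp (fun ω => Gx (x k ω) (y (k + 1) ω) (ωx k ω)) 2 P := by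
  have h := (memLp_noise_x hgen hprob hτ hσ hx₀ hy₀ hnoise k).add
    (memLp_gradX_comp hprob (measurable_x hgen hprob hτ hσ hnoise k)
      (measurable_y hgen hprob hτ hσ hnoise (k + 1)) hxL hyL (hgen.x_mem hprob hτ hx₀ _)
      (hgen.y_mem hprob hσ hy₀ _))
  refine h.ae_eq (ae_of_all _ fun ω => ?_)
  simp

lemma memLp_Gy_of_memLp (hgen : IsGenerated f g Gx Gy ωx ωy τ σ θ x₀ y₀ x y)
    (hprob : ProblemAssumption f g Φ μx μy Lxx Lxy Lyx Lyy) (hτ : 0 < τ) (hσ : 0 < σ)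
    (hx₀ : x₀ ∈ effDom f) (hy₀ : y₀ ∈ effDom g)
    (hnoise : NoiseAssumption P Φ Gx Gy ωx ωy δx δy x y) (j : ℕ)
    (hxL : MemLp (x (j - 1)) 2 P) (hyL : MemLp (y (j - 1)) 2 P) :
    MemLp (fun ω => Gy (x (j - 1) ω) (y (j - 1) ω) (ωy j ω)) 2 P := by
  have h := (memLp_noise_y hgen hprob hτ hσ hx₀ hy₀ hnoise j).add
    (memLp_gradY_comp hprob (measurable_x hgen hprob hτ hσ hnoise _)
      (measurable_y hgen hprob hτ hσ hnoise _) hxL hyL (hgen.x_mem hprob hτ hx₀ _)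
      (hgen.y_mem hprob hσ hy₀ _))
  refine h.ae_eq (ae_of_all _ fun ω => ?_)
  simp

lemma memLp_iterates (hgen : IsGenerated f g Gx Gy ωx ωy τ σ θ x₀ y₀ x y)
    (hprob : ProblemAssumption f g Φ μx μy Lxx Lxy Lyx Lyy) (hτ : 0 < τ) (hσ : 0 < σ)
    (hx₀ : x₀ ∈ effDom f) (hy₀ : y₀ ∈ effDom g)
    (hnoise : NoiseAssumption P Φ Gx Gy ωx ωy δx δy x y) (k : ℕ) :
    MemLp (x k) 2 P ∧ MemLp (y k) 2 P := by
  induction k using Nat.strong_induction_on with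
  | _ k ih =>
    cases k with
    | zero =>
      rw [show x 0 = fun _ => x₀ from funext hgen.x_zero,
        show y 0 = fun _ => y₀ from funext hgen.y_zero]
      exact ⟨memLp_const _, memLp_const _⟩
    | succ k =>
      have hk := ih k (by simp)
      -- The momentum reaches one iterate further back, which is why the induction is strong; for `k
      -- = 0` the truncated index gives the starting point.
      have hk' := ih (k - 1) (by omega)
      have h1 := memLp_Gy_of_memLp hgen hprob hτ hσ hx₀ hy₀ hnoise (k + 1) hk.1 hk.2
      have h2 := memLp_Gy_of_memLp hgen hprob hτ hσ hx₀ hy₀ hnoise k hk'.1 hk'.2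
      have hy : MemLp (y (k + 1)) 2 P := by
        rw [hgen.y_succ_eq hprob hσ k]
        exact memLp_proxMap_comp hprob.g_convex hσ
          (hk.2.add ((h1.add ((h1.sub h2).const_smul θ)).const_smul σ))
      have h3 := memLp_Gx_of_memLp hgen hprob hτ hσ hx₀ hy₀ hnoise k hk.1 hy
      refine ⟨?_, hy⟩
      rw [hgen.x_succ_eq hprob hτ k]
      exact memLp_proxMap_comp hprob.f_convex hτ (hk.1.sub (h3.const_smul τ))

end Iterates

/-! ### The recursion in expectation and its consequences. -/

section Expectation

lemma integral_le_of_condExp_le {Ω : Type*} {m m₀ : MeasurableSpace Ω} {P : Measure Ω}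
    [IsProbabilityMeasure P] (hm : m ≤ m₀) {F : Ω → ℝ} {c : ℝ} (h : P[F | m] ≤ᵐ[P] fun _ => c) :
    ∫ ω, F ω ∂P ≤ c := by
  rw [← integral_condExp hm]
  refine (integral_mono_ae integrable_condExp (integrable_const c) h).trans_eq ?_
  simp

lemma integral_add₃ {Ω : Type*} [MeasurableSpace Ω] {P : Measure Ω} {a b c : Ω → ℝ}
    (ha : Integrable a P) (hb : Integrable b P) (hc : Integrable c P) :
    ∫ ω, (a ω + b ω + c ω) ∂P = ∫ ω, a ω ∂P + ∫ ω, b ω ∂P + ∫ ω, c ω ∂P := by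
  rw [integral_add (f := fun ω => a ω + b ω) (ha.add hb) hc, integral_add ha hb]

lemma integral_add₄ {Ω : Type*} [MeasurableSpace Ω] {P : Measure Ω} {a b c d : Ω → ℝ}
    (ha : Integrable a P) (hb : Integrable b P) (hc : Integrable c P) (hd : Integrable d P) :
    ∫ ω, (a ω + b ω + c ω + d ω) ∂P =
      ∫ ω, a ω ∂P + ∫ ω, b ω ∂P + ∫ ω, c ω ∂P + ∫ ω, d ω ∂P := by
  rw [integral_add (f := fun ω => a ω + b ω + c ω) ((ha.add hb).add hc) hd,
    integral_add₃ ha hb hc]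

variable {X Y Ω Wx Wy : Type*}
  [NormedAddCommGroup X] [InnerProductSpace ℝ X] [FiniteDimensional ℝ X] [CompleteSpace X]
  [MeasurableSpace X] [BorelSpace X]
  [NormedAddCommGroup Y] [InnerProductSpace ℝ Y] [FiniteDimensional ℝ Y] [CompleteSpace Y]
  [MeasurableSpace Y] [BorelSpace Y]
  [MeasurableSpace Ω] [MeasurableSpace Wx] [MeasurableSpace Wy]
  {P : Measure Ω} [IsProbabilityMeasure P]
  {f : X → EReal} {g : Y → EReal} {Φ : X → Y → ℝ} {μx μy Lxx Lxy Lyx Lyy : ℝ}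
  {Gx : X → Y → Wx → X} {Gy : X → Y → Wy → Y} {ωx : ℕ → Ω → Wx} {ωy : ℕ → Ω → Wy}
  {τ σ θ α ρ : ℝ} {x₀ xs : X} {y₀ ys : Y} {x : ℕ → Ω → X} {y : ℕ → Ω → Y} {δx δy : ℝ}

lemma integral_inner_noise_x (hgen : IsGenerated f g Gx Gy ωx ωy τ σ θ x₀ y₀ x y)
    (hprob : ProblemAssumption f g Φ μx μy Lxx Lxy Lyx Lyy) (hτ : 0 < τ) (hσ : 0 < σ)
    (hx₀ : x₀ ∈ effDom f) (hy₀ : y₀ ∈ effDom g)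
    (hnoise : NoiseAssumption P Φ Gx Gy ωx ωy δx δy x y) (k : ℕ) {V : Ω → X}
    (hV : Measurable[history ωx ωy k (k + 2)] V) (hVL : MemLp V 2 P) :
    ∫ ω, inner ℝ (Gx (x k ω) (y (k + 1) ω) (ωx k ω) - gradX Φ (x k ω) (y (k + 1) ω)) (V ω) ∂P
      = 0 := by
  have hle := history_le hnoise.measurable_ωx hnoise.measurable_ωy k (k + 2)
  have hx : Measurable[history ωx ωy k (k + 2)] (x k) :=
    (measurable_iterates hgen hprob hτ hσ hnoise k k le_rfl).1.mono
      (history_mono le_rfl (by simp)) le_rfl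
  have hy := measurable_iterates_y_succ hgen hprob hτ hσ hnoise k
  have hp := hx.prodMk hy
  have hG : Measurable (fun z : (X × Y) × Wx => Gx z.1.1 z.1.2 z.2) :=
    hnoise.measurable_Gx.comp (by fun_prop : Measurable fun z : (X × Y) × Wx =>
      (z.1.1, z.1.2, z.2))
  exact integral_inner_eq_zero_of_indepFun (p := fun ω => (x k ω, y (k + 1) ω))
    (h := fun ω => gradX Φ (x k ω) (y (k + 1) ω)) hG
    (hp.mono hle le_rfl) (hV.mono hle le_rfl) (hnoise.measurable_ωx k)
    (indepFun_history_x hnoise.measurable_ωx hnoise.measurable_ωy hnoise.indep_x hnoise.indep_y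
      hnoise.indep_xy (hp.prodMk hV))
    (hnoise.integrable_x k) (hnoise.unbiased_x k)
    (memLp_noise_x hgen hprob hτ hσ hx₀ hy₀ hnoise k) hVL

lemma integral_inner_noise_y (hgen : IsGenerated f g Gx Gy ωx ωy τ σ θ x₀ y₀ x y)
    (hprob : ProblemAssumption f g Φ μx μy Lxx Lxy Lyx Lyy) (hτ : 0 < τ) (hσ : 0 < σ)
    (hx₀ : x₀ ∈ effDom f) (hy₀ : y₀ ∈ effDom g)
    (hnoise : NoiseAssumption P Φ Gx Gy ωx ωy δx δy x y) (k : ℕ) {V : Ω → Y}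
    (hV : Measurable[history ωx ωy k (k + 1)] V) (hVL : MemLp V 2 P) :
    ∫ ω, inner ℝ (Gy (x k ω) (y k ω) (ωy (k + 1) ω) - gradY Φ (x k ω) (y k ω)) (V ω) ∂P = 0 := by
  have hle := history_le hnoise.measurable_ωx hnoise.measurable_ωy k (k + 1)
  have hxy := measurable_iterates hgen hprob hτ hσ hnoise k k le_rfl
  have hp := hxy.1.prodMk hxy.2
  have hG : Measurable (fun z : (X × Y) × Wy => Gy z.1.1 z.1.2 z.2) :=
    hnoise.measurable_Gy.comp (by fun_prop : Measurable fun z : (X × Y) × Wy =>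
      (z.1.1, z.1.2, z.2))
  exact integral_inner_eq_zero_of_indepFun (p := fun ω => (x k ω, y k ω))
    (h := fun ω => gradY Φ (x k ω) (y k ω)) hG
    (hp.mono hle le_rfl) (hV.mono hle le_rfl) (hnoise.measurable_ωy (k + 1))
    (indepFun_history_y hnoise.measurable_ωx hnoise.measurable_ωy hnoise.indep_x hnoise.indep_y
      hnoise.indep_xy (hp.prodMk hV))
    (hnoise.integrable_y (k + 1)) (hnoise.unbiased_y (k + 1))
    (memLp_noise_y hgen hprob hτ hσ hx₀ hy₀ hnoise (k + 1)) hVL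

lemma integral_noise_x_sq_le (hgen : IsGenerated f g Gx Gy ωx ωy τ σ θ x₀ y₀ x y)
    (hprob : ProblemAssumption f g Φ μx μy Lxx Lxy Lyx Lyy) (hτ : 0 < τ) (hσ : 0 < σ)
    (hnoise : NoiseAssumption P Φ Gx Gy ωx ωy δx δy x y) (k : ℕ) :
    ∫ ω, ‖Gx (x k ω) (y (k + 1) ω) (ωx k ω) - gradX Φ (x k ω) (y (k + 1) ω)‖ ^ 2 ∂P ≤ δx ^ 2 :=
  integral_le_of_condExp_le ((measurable_x hgen hprob hτ hσ hnoise k).prodMk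
    (measurable_y hgen hprob hτ hσ hnoise (k + 1))).comap_le (hnoise.variance_x k)

lemma integral_noise_y_sq_le (hgen : IsGenerated f g Gx Gy ωx ωy τ σ θ x₀ y₀ x y)
    (hprob : ProblemAssumption f g Φ μx μy Lxx Lxy Lyx Lyy) (hτ : 0 < τ) (hσ : 0 < σ)
    (hnoise : NoiseAssumption P Φ Gx Gy ωx ωy δx δy x y) (k : ℕ) :
    ∫ ω, ‖Gy (x k ω) (y k ω) (ωy (k + 1) ω) - gradY Φ (x k ω) (y k ω)‖ ^ 2 ∂P ≤ δy ^ 2 :=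
  integral_le_of_condExp_le ((measurable_x hgen hprob hτ hσ hnoise k).prodMk
    (measurable_y hgen hprob hτ hσ hnoise k)).comap_le (hnoise.variance_y (k + 1))

lemma integrable_lyapunov (hgen : IsGenerated f g Gx Gy ωx ωy τ σ θ x₀ y₀ x y)
    (hprob : ProblemAssumption f g Φ μx μy Lxx Lxy Lyx Lyy) (hτ : 0 < τ) (hσ : 0 < σ)
    (hx₀ : x₀ ∈ effDom f) (hy₀ : y₀ ∈ effDom g)
    (hnoise : NoiseAssumption P Φ Gx Gy ωx ωy δx δy x y) (k : ℕ) :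
    Integrable (fun ω => lyapunov Φ μx μy Lxx τ σ α xs ys
      (x (k + 1) ω) (x k ω) (y (k + 1) ω) (y k ω)) P := by
  have hL := memLp_iterates hgen hprob hτ hσ hx₀ hy₀ hnoise
  have hgrad : ∀ k, MemLp (fun ω => gradY Φ (x k ω) (y k ω)) 2 P := fun k =>
    memLp_gradY_comp hprob (measurable_x hgen hprob hτ hσ hnoise k)
      (measurable_y hgen hprob hτ hσ hnoise k) (hL k).1 (hL k).2
      (hgen.x_mem hprob hτ hx₀ k) (hgen.y_mem hprob hσ hy₀ k)
  have i1 := (((hL (k + 1)).1.sub (memLp_const xs)).norm.integrable_sq).const_mul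
    ((1 / τ + μx) / 2)
  have i2 := (((hL (k + 1)).2.sub (memLp_const ys)).norm.integrable_sq).const_mul
    ((1 / σ + μy) / 2)
  have i3 := integrable_inner_of_memLp ((hgrad (k + 1)).sub (hgrad k))
    ((memLp_const ys).sub (hL (k + 1)).2)
  have i4 := (((hL (k + 1)).1.sub (hL k).1).norm.integrable_sq).const_mul ((1 / τ - Lxx) / 2)
  have i5 := (((hL (k + 1)).2.sub (hL k).2).norm.integrable_sq).const_mul ((1 / σ - α) / 2)
  exact (((i1.add i2).sub i3).add i4).add i5

/-- The expected Lyapunov function contracts up to the variance constant. -/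
lemma integral_lyapunov_succ_le (hgen : IsGenerated f g Gx Gy ωx ωy τ σ θ x₀ y₀ x y)
    (hprob : ProblemAssumption f g Φ μx μy Lxx Lxy Lyx Lyy)
    (hsaddle : IsSaddlePoint f g Φ xs ys) (hτ : 0 < τ) (hσ : 0 < σ) (hθ : 0 ≤ θ)
    (hx₀ : x₀ ∈ effDom f) (hy₀ : y₀ ∈ effDom g)
    (hnoise : NoiseAssumption P Φ Gx Gy ωx ωy δx δy x y) (hρ : 0 < ρ)
    (hG : (lmiMatrix μx μy Lxx Lyx Lyy τ σ θ α ρ).PosSemidef) (n : ℕ) :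
    ∫ ω, lyapunov Φ μx μy Lxx τ σ α xs ys
        (x (n + 2) ω) (x (n + 1) ω) (y (n + 2) ω) (y (n + 1) ω) ∂P ≤
      ρ * ∫ ω, lyapunov Φ μx μy Lxx τ σ α xs ys
        (x (n + 1) ω) (x n ω) (y (n + 1) ω) (y n ω) ∂P
      + noiseRemainder μx μy Lxy Lyx Lyy τ σ θ δx δx δy δy := by
  have hμx := hprob.f_convex.modulus_nonneg
  have hμy := hprob.g_convex.modulus_nonneg
  have hLyx := hprob.Lyx_pos.le
  have hLxy := hprob.Lxy_pos.le
  have hLyy := hprob.Lyy_nonneg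
  have hxd := hgen.x_mem hprob hτ hx₀
  have hyd := hgen.y_mem hprob hσ hy₀
  have hL := memLp_iterates hgen hprob hτ hσ hx₀ hy₀ hnoise
  have hmx := measurable_x hgen hprob hτ hσ hnoise
  have hmy := measurable_y hgen hprob hτ hσ hnoise
  have hle := history_le hnoise.measurable_ωx hnoise.measurable_ωy
  -- Mind the shift: `gy k` is the estimate at iterate `k - 1`, while `E k` is the error at iterate
  -- `k`, made with the sample `ωy (k + 1)`.
  set gy : ℕ → Ω → Y := fun k ω => Gy (x (k - 1) ω) (y (k - 1) ω) (ωy k ω) with hgy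
  set D : ℕ → Ω → X := fun k ω =>
    Gx (x k ω) (y (k + 1) ω) (ωx k ω) - gradX Φ (x k ω) (y (k + 1) ω) with hD
  set E : ℕ → Ω → Y := fun k ω =>
    Gy (x k ω) (y k ω) (ωy (k + 1) ω) - gradY Φ (x k ω) (y k ω) with hE
  set yb : ℕ → Ω → Y := fun k ω => exactDualStep Φ g σ θ (gy k ω) (x k ω) (y k ω) with hyb
  set xh₁ : Ω → X := fun ω => exactPrimalStep Φ f τ (x (n + 1) ω) (y (n + 2) ω) with hxh₁
  set xh : Ω → X := fun ω => exactPrimalStep Φ f τ (x n ω) (yb n ω) with hxh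
  -- With the exact gradient at iterate `n` in the momentum slot, `yh` no longer involves `ωy (n +
  -- 1)`, the sample in `E n`.
  set yh : Ω → Y := fun ω => exactDualStep Φ g σ θ (gradY Φ (x n ω) (y n ω)) (xh ω) (yb n ω)
    with hyh
  have hybd : ∀ k ω, yb k ω ∈ effDom g := fun k ω => proxMap_mem hprob.g_convex hσ _
  have hxhd : ∀ ω, xh ω ∈ effDom f := fun ω => proxMap_mem hprob.f_convex hτ _
  -- measurability with respect to the history
  have hmgy : ∀ k, Measurable[history ωx ωy k (k + 1)] (gy k) := fun k =>
    measurable_oracle_comp hnoise.measurable_Gy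
      (measurable_iterates hgen hprob hτ hσ hnoise k (k - 1) (Nat.sub_le k 1)).1
      (measurable_iterates hgen hprob hτ hσ hnoise k (k - 1) (Nat.sub_le k 1)).2
      (measurable_history_y (by simp))
  have hmyb : ∀ k, Measurable[history ωx ωy k (k + 1)] (yb k) := fun k =>
    measurable_exactDualStep hprob hσ (hmgy k)
      (measurable_iterates hgen hprob hτ hσ hnoise k k le_rfl).1
      (measurable_iterates hgen hprob hτ hσ hnoise k k le_rfl).2 (hxd k) (hyd k)
  have hmxh₁ : Measurable[history ωx ωy (n + 1) (n + 1 + 2)] xh₁ :=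
    measurable_exactPrimalStep hprob hτ
      ((measurable_iterates hgen hprob hτ hσ hnoise (n + 1) (n + 1) le_rfl).1.mono
        (history_mono le_rfl (by simp)) le_rfl)
      (measurable_iterates_y_succ hgen hprob hτ hσ hnoise (n + 1)) (hxd _) (hyd _)
  have hmxh : Measurable[history ωx ωy n (n + 1)] xh :=
    measurable_exactPrimalStep hprob hτ
      (measurable_iterates hgen hprob hτ hσ hnoise n n le_rfl).1 (hmyb n) (hxd _) (hybd n)
  have hmyh : Measurable[history ωx ωy n (n + 1)] yh :=
    measurable_exactDualStep hprob hσ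
      (measurable_gradY_comp hprob (measurable_iterates hgen hprob hτ hσ hnoise n n le_rfl).1
        (measurable_iterates hgen hprob hτ hσ hnoise n n le_rfl).2 (hxd _) (hyd _))
      hmxh (hmyb n) hxhd (hybd n)
  -- square integrability
  have hLgy : ∀ k, MemLp (gy k) 2 P := fun k =>
    memLp_Gy_of_memLp hgen hprob hτ hσ hx₀ hy₀ hnoise k (hL _).1 (hL _).2
  have hLyb : ∀ k, MemLp (yb k) 2 P := fun k =>
    memLp_exactDualStep hprob hσ (hmx k) (hmy k) (hLgy k) (hL k).1 (hL k).2 (hxd k) (hyd k)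
  have hLxh₁ : MemLp xh₁ 2 P :=
    memLp_exactPrimalStep hprob hτ (hmx _) (hmy _) (hL _).1 (hL _).2 (hxd _) (hyd _)
  have hLxh : MemLp xh 2 P :=
    memLp_exactPrimalStep hprob hτ (hmx _) ((hmyb n).mono (hle _ _) le_rfl) (hL _).1 (hLyb n)
      (hxd _) (hybd n)
  have hLyh : MemLp yh 2 P :=
    memLp_exactDualStep hprob hσ (hmxh.mono (hle _ _) le_rfl) ((hmyb n).mono (hle _ _) le_rfl)
      (memLp_gradY_comp hprob (hmx n) (hmy n) (hL n).1 (hL n).2 (hxd n) (hyd n)) hLxh (hLyb n)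
      hxhd (hybd n)
  have hLD : ∀ k, MemLp (D k) 2 P := memLp_noise_x hgen hprob hτ hσ hx₀ hy₀ hnoise
  have hLE : ∀ k, MemLp (E k) 2 P := fun k =>
    memLp_noise_y hgen hprob hτ hσ hx₀ hy₀ hnoise (k + 1)
  -- the martingale part has zero mean
  have z1 : ∫ ω, inner ℝ (D (n + 1) ω) (xh₁ ω - xs) ∂P = 0 :=
    integral_inner_noise_x hgen hprob hτ hσ hx₀ hy₀ hnoise (n + 1)
      (hmxh₁.sub measurable_const) (hLxh₁.sub (memLp_const xs))
  have z2 : ∫ ω, inner ℝ (E (n + 1) ω) (yb (n + 1) ω - ys) ∂P = 0 :=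
    integral_inner_noise_y hgen hprob hτ hσ hx₀ hy₀ hnoise (n + 1)
      ((hmyb (n + 1)).sub measurable_const) ((hLyb (n + 1)).sub (memLp_const ys))
  have z3 : ∫ ω, inner ℝ (E n ω) (yh ω - ys) ∂P = 0 :=
    integral_inner_noise_y hgen hprob hτ hσ hx₀ hy₀ hnoise n
      (hmyh.sub measurable_const) (hLyh.sub (memLp_const ys))
  have j1 : Integrable (fun ω => inner ℝ (D (n + 1) ω) (xh₁ ω - xs)) P :=
    integrable_inner_of_memLp (hLD (n + 1)) (hLxh₁.sub (memLp_const xs))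
  have j2 : Integrable (fun ω => inner ℝ (E (n + 1) ω) (yb (n + 1) ω - ys)) P :=
    integrable_inner_of_memLp (hLE (n + 1)) ((hLyb (n + 1)).sub (memLp_const ys))
  have j3 : Integrable (fun ω => inner ℝ (E n ω) (yh ω - ys)) P :=
    integrable_inner_of_memLp (hLE n) (hLyh.sub (memLp_const ys))
  have hMint : Integrable (fun ω => martingaleNoise θ (D (n + 1) ω) (E (n + 1) ω) (E n ω)
      xs (xh₁ ω) ys (yb (n + 1) ω) (yh ω)) P :=
    (j1.neg.add (j2.const_mul (1 + θ))).sub (j3.const_mul θ)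
  have hMzero : ∫ ω, martingaleNoise θ (D (n + 1) ω) (E (n + 1) ω) (E n ω)
      xs (xh₁ ω) ys (yb (n + 1) ω) (yh ω) ∂P = 0 := by
    simp only [martingaleNoise, sub_eq_add_neg (_ + _)]
    refine (integral_add₃ j1.neg (j2.const_mul (1 + θ)) (j3.const_mul θ).neg).trans ?_
    simp only [Pi.neg_apply, integral_neg, integral_const_mul, z1, z2, z3]
    simp
  -- the quadratic remainder
  have hRint : Integrable (fun ω => noiseRemainder μx μy Lxy Lyx Lyy τ σ θ
      ‖D (n + 1) ω‖ ‖D n ω‖ ‖E (n + 1) ω‖ ‖E n ω‖) P :=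
    ((((hLD (n + 1)).norm.integrable_sq.const_mul _).add
      ((hLD n).norm.integrable_sq.const_mul _)).add
      ((hLE (n + 1)).norm.integrable_sq.const_mul _)).add
      ((hLE n).norm.integrable_sq.const_mul _)
  have v1 : ∀ k, ∫ ω, ‖D k ω‖ ^ 2 ∂P ≤ δx ^ 2 :=
    integral_noise_x_sq_le hgen hprob hτ hσ hnoise
  have v2 : ∀ k, ∫ ω, ‖E k ω‖ ^ 2 ∂P ≤ δy ^ 2 :=
    integral_noise_y_sq_le hgen hprob hτ hσ hnoise
  have hRle : ∫ ω, noiseRemainder μx μy Lxy Lyx Lyy τ σ θ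
      ‖D (n + 1) ω‖ ‖D n ω‖ ‖E (n + 1) ω‖ ‖E n ω‖ ∂P ≤
      noiseRemainder μx μy Lxy Lyx Lyy τ σ θ δx δx δy δy := by
    simp only [noiseRemainder]
    rw [integral_add₄ ((hLD (n + 1)).norm.integrable_sq.const_mul _)
        ((hLD n).norm.integrable_sq.const_mul _) ((hLE (n + 1)).norm.integrable_sq.const_mul _)
        ((hLE n).norm.integrable_sq.const_mul _),
      integral_const_mul, integral_const_mul, integral_const_mul, integral_const_mul]
    have hA : 0 ≤ 1 / (1 + σ * μy) := by positivity
    have hB : 0 ≤ 1 / (1 + τ * μx) := by positivity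
    exact add_le_add (add_le_add (add_le_add
      (mul_le_mul_of_nonneg_left (v1 _) (by positivity))
      (mul_le_mul_of_nonneg_left (v1 _) (by positivity)))
      (mul_le_mul_of_nonneg_left (v2 _) (by positivity)))
      (mul_le_mul_of_nonneg_left (v2 _) (by positivity))
  -- the pathwise estimate
  have hpath : ∀ ω, lyapunov Φ μx μy Lxx τ σ α xs ys
        (x (n + 2) ω) (x (n + 1) ω) (y (n + 2) ω) (y (n + 1) ω) ≤
      ρ * lyapunov Φ μx μy Lxx τ σ α xs ys (x (n + 1) ω) (x n ω) (y (n + 1) ω) (y n ω)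
      + martingaleNoise θ (D (n + 1) ω) (E (n + 1) ω) (E n ω)
        xs (xh₁ ω) ys (yb (n + 1) ω) (yh ω)
      + noiseRemainder μx μy Lxy Lyx Lyy τ σ θ
        ‖D (n + 1) ω‖ ‖D n ω‖ ‖E (n + 1) ω‖ ‖E n ω‖ := by
    intro ω
    have h1 := lyapunov_le_lyapunovStep_add_noise (α := α) (θ := θ) (x' := x n ω) (y' := y n ω)
      hprob hsaddle hτ hσ (hxd (n + 1) ω) (hgen.y_step (n + 1) ω) (hgen.x_step (n + 1) ω)
    have h2 := lyapunovStep_le (xs := xs) (ys := ys) hprob hG hρ hθ (hxd (n + 1) ω) (hxd n ω)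
      (hyd (n + 1) ω) (hyd n ω) (y (n + 1) ω - y (n + 2) ω)
    have h3 := noise_le (xs := xs) (ys := ys) hprob hτ hσ hθ (hxd n ω) (hgen.y_step n ω)
      (hgen.x_step n ω) (hgen.y_step (n + 1) ω) (hgen.x_step (n + 1) ω)
    -- The predecessor of `n + 1` is `n`. The estimate before iterate `n` enters `noise_le` only as
    -- the arbitrary vector `w`, so `n = 0` needs no separate treatment.
    simp only [add_tsub_cancel_right] at h1 h3
    exact (h1.trans_eq (add_sub_assoc _ _ _)).trans
      ((add_le_add h2 h3).trans_eq (add_assoc _ _ _).symm)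
  have hA := integrable_lyapunov (α := α) (xs := xs) (ys := ys) hgen hprob hτ hσ hx₀ hy₀ hnoise
  calc _ ≤ ∫ ω, (ρ * lyapunov Φ μx μy Lxx τ σ α xs ys (x (n + 1) ω) (x n ω) (y (n + 1) ω) (y n ω)
      + martingaleNoise θ (D (n + 1) ω) (E (n + 1) ω) (E n ω)
        xs (xh₁ ω) ys (yb (n + 1) ω) (yh ω)
      + noiseRemainder μx μy Lxy Lyx Lyy τ σ θ
        ‖D (n + 1) ω‖ ‖D n ω‖ ‖E (n + 1) ω‖ ‖E n ω‖) ∂P :=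
        integral_mono (hA (n + 1)) ((((hA n).const_mul ρ).add hMint).add hRint) hpath
    _ ≤ _ := by
        rw [integral_add₃ ((hA n).const_mul ρ) hMint hRint, integral_const_mul, hMzero, add_zero]
        gcongr

/-- `K / (1 - ρ)` is the fixed point of `t ↦ ρ * t + K`, and the distance to it contracts. -/
lemma le_geometric_of_succ_le {a : ℕ → ℝ} {K : ℝ} (hρ₀ : 0 < ρ) (hρ₁ : ρ < 1)
    (h : ∀ n, a (n + 1) ≤ ρ * a n + K) (n : ℕ) :
    a n ≤ K / (1 - ρ) + ρ ^ n * (a 0 - K / (1 - ρ)) := by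
  have hK : ρ * (K / (1 - ρ)) + K = K / (1 - ρ) := by
    have : 1 - ρ ≠ 0 := by linarith
    field_simp; ring
  induction n with
  | zero => simp
  | succ n ih =>
    refine (h n).trans ?_
    have := mul_le_mul_of_nonneg_left ih hρ₀.le
    rw [pow_succ]
    linarith

lemma normalizedVariance_succ_le (hgen : IsGenerated f g Gx Gy ωx ωy τ σ θ x₀ y₀ x y)
    (hprob : ProblemAssumption f g Φ μx μy Lxx Lxy Lyx Lyy) (hτ : 0 < τ) (hσ : 0 < σ)
    (hθ : 0 ≤ θ) (hx₀ : x₀ ∈ effDom f) (hy₀ : y₀ ∈ effDom g)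
    (hnoise : NoiseAssumption P Φ Gx Gy ωx ωy δx δy x y) (hδx : 0 < δx) (hδy : 0 < δy)
    (hρ : 0 < ρ) (hC : 0 < cMin τ σ α ρ)
    (hG : (lmiMatrix μx μy Lxx Lyx Lyy τ σ θ α ρ).PosSemidef) (n : ℕ) :
    normalizedVariance P δx δy xs ys x y (n + 1) ≤
      ENNReal.ofReal (1 / (min δx δy ^ 2 * cMin τ σ α ρ) *
        ∫ ω, lyapunov Φ μx μy Lxx τ σ α xs ys
          (x (n + 1) ω) (x n ω) (y (n + 1) ω) (y n ω) ∂P) := by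
  have hδ : 0 < min δx δy := lt_min hδx hδy
  have hpt : ∀ ω, 1 / δx ^ 2 * ‖x (n + 1) ω - xs‖ ^ 2 + 1 / δy ^ 2 * ‖y (n + 1) ω - ys‖ ^ 2 ≤
      1 / (min δx δy ^ 2 * cMin τ σ α ρ) * lyapunov Φ μx μy Lxx τ σ α xs ys
          (x (n + 1) ω) (x n ω) (y (n + 1) ω) (y n ω) := by
    intro ω
    have h := cMin_mul_le_lyapunov (xs := xs) (ys := ys) hprob hG hρ hθ hσ
      (hgen.x_mem hprob hτ hx₀ (n + 1) ω) (hgen.x_mem hprob hτ hx₀ n ω)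
      (hgen.y_mem hprob hσ hy₀ (n + 1) ω) (hgen.y_mem hprob hσ hy₀ n ω)
    calc _ ≤ 1 / min δx δy ^ 2 * ‖x (n + 1) ω - xs‖ ^ 2
          + 1 / min δx δy ^ 2 * ‖y (n + 1) ω - ys‖ ^ 2 := by
          gcongr
          · exact min_le_left _ _
          · exact min_le_right _ _
      _ = 1 / (min δx δy ^ 2 * cMin τ σ α ρ) *
          (cMin τ σ α ρ * (‖x (n + 1) ω - xs‖ ^ 2 + ‖y (n + 1) ω - ys‖ ^ 2)) := by
          field_simp
      _ ≤ _ := by gcongr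
  rw [normalizedVariance, ← integral_const_mul, ofReal_integral_eq_lintegral_ofReal]
  · exact lintegral_mono fun ω => ENNReal.ofReal_le_ofReal (hpt ω)
  · exact (integrable_lyapunov hgen hprob hτ hσ hx₀ hy₀ hnoise n).const_mul _
  · exact ae_of_all _ fun ω => le_trans (by positivity) (hpt ω)

end Expectation

end SAPD

/-! ### The main theorem. -/

open SAPD in
theorem mainTheorem7 {X Y Ω Wx Wy : Type*}
    [NormedAddCommGroup X] [InnerProductSpace ℝ X] [FiniteDimensional ℝ X] [CompleteSpace X]
    [MeasurableSpace X] [BorelSpace X]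
    [NormedAddCommGroup Y] [InnerProductSpace ℝ Y] [FiniteDimensional ℝ Y] [CompleteSpace Y]
    [MeasurableSpace Y] [BorelSpace Y]
    [MeasurableSpace Ω] [MeasurableSpace Wx] [MeasurableSpace Wy]
    (P : Measure Ω) [IsProbabilityMeasure P]
    (f : X → EReal) (g : Y → EReal) (Φ : X → Y → ℝ) (μx μy Lxx Lxy Lyx Lyy : ℝ)
    (hprob : SAPD.ProblemAssumption f g Φ μx μy Lxx Lxy Lyx Lyy)
    (xs : X) (ys : Y) (hsaddle : SAPD.IsSaddlePoint f g Φ xs ys)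
    (Gx : X → Y → Wx → X) (Gy : X → Y → Wy → Y) (ωx : ℕ → Ω → Wx) (ωy : ℕ → Ω → Wy)
    (τ σ θ : ℝ) (hτ : 0 < τ) (hσ : 0 < σ) (hθ : 0 ≤ θ)
    (x₀ : X) (y₀ : Y) (hx₀ : x₀ ∈ SAPD.effDom f) (hy₀ : y₀ ∈ SAPD.effDom g)
    (x : ℕ → Ω → X) (y : ℕ → Ω → Y)
    (hgen : SAPD.IsGenerated f g Gx Gy ωx ωy τ σ θ x₀ y₀ x y)
    (δx δy : ℝ) (hδx : 0 < δx) (hδy : 0 < δy)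
    (hnoise : SAPD.NoiseAssumption P Φ Gx Gy ωx ωy δx δy x y)
    (α ρ : ℝ) (hα₀ : 0 ≤ α) (hα₁ : α < 1 / σ) (hρ₀ : 0 < ρ) (hρ₁ : ρ < 1)
    (hG : (SAPD.lmiMatrix μx μy Lxx Lyx Lyy τ σ θ α ρ).PosSemidef)
    (ηx ηy : ℝ) (hηx : 0 < ηx) (hηy : 0 < ηy) :
    SAPD.robustness P δx δy xs ys x y ≤
      ENNReal.ofReal (1 / ((1 - ρ) * (min δx δy) ^ 2) *
        (SAPD.xi μx μy Lxy Lyx Lyy τ σ θ ηx ηy δx δy / SAPD.cMin τ σ α ρ)) := by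
  have hδ : 0 < min δx δy := lt_min hδx hδy
  -- The strict bound on `α` is what makes `cMin` positive.
  have hασ : 0 < 1 - α * σ := by
    rw [lt_div_iff₀ hσ] at hα₁; linarith
  have hC : 0 < cMin τ σ α ρ := lt_min (by positivity) (by positivity)
  set a : ℕ → ℝ := fun n => ∫ ω, lyapunov Φ μx μy Lxx τ σ α xs ys
    (x (n + 1) ω) (x n ω) (y (n + 1) ω) (y n ω) ∂P
  set K := xi μx μy Lxy Lyx Lyy τ σ θ ηx ηy δx δy
  have hstep : ∀ n, a (n + 1) ≤ ρ * a n + K := fun n =>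
    (integral_lyapunov_succ_le hgen hprob hsaddle hτ hσ hθ hx₀ hy₀ hnoise hρ₀ hG n).trans
      (add_le_add_right (noiseRemainder_le_xi hτ hσ hθ hprob.f_convex.modulus_nonneg
        hprob.g_convex.modulus_nonneg hprob.Lxy_pos.le hprob.Lyx_pos.le hprob.Lyy_nonneg hηx hηy
        δx δy) _)
  have hbound : ∀ n, normalizedVariance P δx δy xs ys x y (n + 1) ≤
      ENNReal.ofReal (1 / (min δx δy ^ 2 * cMin τ σ α ρ) *
        (K / (1 - ρ) + ρ ^ n * (a 0 - K / (1 - ρ)))) := fun n =>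
    (normalizedVariance_succ_le hgen hprob hτ hσ hθ hx₀ hy₀ hnoise hδx hδy hρ₀ hC hG n).trans
      (ENNReal.ofReal_le_ofReal (mul_le_mul_of_nonneg_left
        (le_geometric_of_succ_le hρ₀ hρ₁ hstep n) (by positivity)))
  have hlim : Tendsto (fun n => ENNReal.ofReal (1 / (min δx δy ^ 2 * cMin τ σ α ρ) *
      (K / (1 - ρ) + ρ ^ n * (a 0 - K / (1 - ρ))))) atTop
      (nhds (ENNReal.ofReal (1 / ((1 - ρ) * (min δx δy) ^ 2) * (K / cMin τ σ α ρ)))) := by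
    refine ENNReal.tendsto_ofReal ?_
    have h := (((tendsto_pow_atTop_nhds_zero_of_lt_one hρ₀.le hρ₁).mul_const
      (a 0 - K / (1 - ρ))).const_add (K / (1 - ρ))).const_mul
      (1 / (min δx δy ^ 2 * cMin τ σ α ρ))
    convert h using 2
    have : 1 - ρ ≠ 0 := by linarith
    rw [zero_mul, add_zero]
    field_simp
  -- The bound starts at index one, since `lyapunov` needs a preceding iterate; a shift does not
  -- change the limsup.
  rw [robustness, ← limsup_nat_add _ 1, ← hlim.limsup_eq]
  exact limsup_le_limsup (Eventually.of_forall hbound)
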